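/- Let $n\ge 3$, and let $\mathcal P_o^n$ be the set of all polytopes in $\mathbb R^n$ (convex hulls of finitely many points, of any dimension) that contain the origin $o$. A function $Z:\mathcal P_o^n\to\mathbb R^n$ is called a valuation if $$Z(P)+Z(Q)=Z(P\cup Q)+Z(P\cap Q)$$ whenever $P,Q,P\cup Q,P\cap Q\in\mathcal P_o^n$, and $\mathrm{SL}(n)$ contravariant if $Z(\phi P)=\phi^{-t}Z(P)$ for all $P\in\mathcal P_o^n$ and $\phi\in\mathrm{SL}(n)$ (real $n\times n$ matrices of determinant $1$, with $\phi^{-t}$ the inverse transpose). A solution of Cauchy's functional equation on $[0,\infty)$ is a function $\zeta:[0,\infty)\to\mathbb R$ with $\zeta(a+b)=\zeta(a)+\zeta(b)$ for all $a,b\ge 0$. For a polytope $P$ and a unit vector $u$ write $h_P(u)=\max\{\langle x,u\rangle:x\in P\}$ and $F(P,u)=\{x\in P:\langle x,u\rangle=h_P(u)\}$; let $\mathcal N(P)$ be the (finite) set of unit vectors $u$ for which $F(P,u)$ has dimension $n-1$, let $\mathcal N_o(P)$ be the set of those $u\in\mathcal N(P)$ for which the affine hull of $F(P,u)$ contains $o$,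 and let $V(P,u)$ be the $n$-dimensional volume of $\mathrm{conv}(\{o\}\cup F(P,u))$. The facet vector of $P$ is $$\mathrm{fv}_\zeta(P)=\sum_{u\in\mathcal N(P)\setminus\mathcal N_o(P)}\frac{\zeta(V(P,u))}{|h_P(u)|}\,u .$$ Theorem. A function $Z:\mathcal P_o^n\to\mathbb R^n$ is an $\mathrm{SL}(n)$ contravariant valuation if and only if there exists a solution $\zeta:[0,\infty)\to\mathbb R$ of Cauchy's functional equation such that $Z(P)=\mathrm{fv}_\zeta(P)$ for every $P\in\mathcal P_o^n$. -/

import Mathlib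

open scoped NNReal RealInnerProductSpace

/-- Euclidean space `ℝⁿ`. -/
abbrev RSpace (n : ℕ) : Type := EuclideanSpace ℝ (Fin n)

/-- A polytope in `ℝⁿ`: the convex hull of a nonempty finite set of points (of any dimension). -/
def IsPolytope {n : ℕ} (P : Set (RSpace n)) : Prop :=
  ∃ s : Finset (RSpace n), s.Nonempty ∧ P = convexHull ℝ (s : Set (RSpace n))

/-- The space of all polytopes in `ℝⁿ` that contain the origin. -/
def PolytopeO (n : ℕ) : Type :=
  {P : Set (RSpace n) // IsPolytope P ∧ (0 : RSpace n) ∈ P}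

/-- The image of a polytope containing the origin under `φ ∈ SL(n)`. -/
noncomputable def PolytopeO.image {n : ℕ} (φ : Matrix.SpecialLinearGroup (Fin n) ℝ)
    (P : PolytopeO n) : PolytopeO n :=
  ⟨Matrix.toEuclideanLin φ.1 '' P.1, by
    classical
    obtain ⟨⟨s, hs, hP⟩, h0⟩ := P.2
    refine ⟨⟨s.image (Matrix.toEuclideanLin φ.1), hs.image _, ?_⟩, 0, h0, map_zero _⟩
    rw [hP, LinearMap.image_convexHull, Finset.coe_image]⟩

/-- `Z` is a valuation: `Z(P) + Z(Q) = Z(P ∪ Q) + Z(P ∩ Q)` whenever `P`, `Q`, `P ∪ Q` and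
`P ∩ Q` are all polytopes containing the origin. -/
def IsValuation {n : ℕ} (Z : PolytopeO n → RSpace n) : Prop :=
  ∀ P Q U I : PolytopeO n, U.1 = P.1 ∪ Q.1 → I.1 = P.1 ∩ Q.1 → Z P + Z Q = Z U + Z I

/-- `Z` is `SL(n)` contravariant: `Z(φP) = φ⁻ᵗ Z(P)`. -/
def IsSLContravariant {n : ℕ} (Z : PolytopeO n → RSpace n) : Prop :=
  ∀ (φ : Matrix.SpecialLinearGroup (Fin n) ℝ) (P : PolytopeO n),
    Z (P.image φ) = Matrix.toEuclideanLin (φ⁻¹).1.transpose (Z P)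

/-- A solution `ζ : [0, ∞) → ℝ` of Cauchy's functional equation. -/
def IsCauchySolution (ζ : ℝ≥0 → ℝ) : Prop :=
  ∀ a b : ℝ≥0, ζ (a + b) = ζ a + ζ b

/-- The support function `h_P(u) = max {⟪x, u⟫ : x ∈ P}`. -/
noncomputable def supportFn {n : ℕ} (P : Set (RSpace n)) (u : RSpace n) : ℝ :=
  sSup ((fun x => ⟪x, u⟫) '' P)

/-- `F(P, u)`: the set of points of `P` at which `⟪·, u⟫` is maximal on `P`. -/
def face {n : ℕ} (P : Set (RSpace n)) (u : RSpace n) : Set (RSpace n) :=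
  {x ∈ P | ∀ y ∈ P, ⟪y, u⟫ ≤ ⟪x, u⟫}

/-- The outer unit normals of facets of `P`: the unit vectors `u` for which `F(P, u)` has
dimension `n - 1`. -/
def facetNormals {n : ℕ} (P : Set (RSpace n)) : Set (RSpace n) :=
  {u | ‖u‖ = 1 ∧ Module.finrank ℝ (vectorSpan ℝ (face P u)) + 1 = n}

/-- The outer unit normals of those facets of `P` whose affine hull contains the origin. -/
def facetNormalsO {n : ℕ} (P : Set (RSpace n)) : Set (RSpace n) :=
  {u ∈ facetNormals P | (0 : RSpace n) ∈ affineSpan ℝ (face P u)}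

/-- `V(P, u)`: the volume of the cone `conv {o, F(P, u)}`. -/
noncomputable def coneVolume {n : ℕ} (P : Set (RSpace n)) (u : RSpace n) : ℝ≥0 :=
  (MeasureTheory.volume (convexHull ℝ (insert 0 (face P u)))).toNNReal

/-- The facet vector of `P`. The sum is finite by `IsPolytope.finite_facetNormals` below. -/
noncomputable def facetVector {n : ℕ} (ζ : ℝ≥0 → ℝ) (P : Set (RSpace n)) : RSpace n :=
  ∑ᶠ u ∈ facetNormals P \ facetNormalsO P, (ζ (coneVolume P u) / |supportFn P u|) • u

/-- The supremum in the support function of a polytope is a maximum. -/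
theorem IsPolytope.isGreatest_supportFn {n : ℕ} {P : Set (RSpace n)} (hP : IsPolytope P)
    (u : RSpace n) : IsGreatest ((fun x => ⟪x, u⟫) '' P) (supportFn P u) := by
  obtain ⟨s, hs, rfl⟩ := hP
  have hc : IsCompact (convexHull ℝ (s : Set (RSpace n))) :=
    s.finite_toSet.isCompact_convexHull ℝ
  have hne : (convexHull ℝ (s : Set (RSpace n))).Nonempty := by simpa using hs
  exact (hc.image (by fun_prop)).isGreatest_sSup (hne.image _)

/-- The cones used in the facet vector of a polytope have finite volume. -/
theorem IsPolytope.volume_cone_ne_top {n : ℕ} {P : Set (RSpace n)} (hP : IsPolytope P)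
    (u : RSpace n) : MeasureTheory.volume (convexHull ℝ (insert 0 (face P u))) ≠ ⊤ := by
  obtain ⟨s, hs, rfl⟩ := hP
  have hc : IsCompact (convexHull ℝ (s : Set (RSpace n))) :=
    s.finite_toSet.isCompact_convexHull ℝ
  have hb : Bornology.IsBounded (face (convexHull ℝ (s : Set (RSpace n))) u) :=
    hc.isBounded.subset fun x hx => hx.1
  exact (isBounded_convexHull.2 (hb.insert 0)).measure_lt_top.ne

/-- A face of a polytope is spanned by the generating points that it contains. -/
theorem face_convexHull_subset {n : ℕ} (s : Set (RSpace n)) (u : RSpace n) :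
    face (convexHull ℝ s) u ⊆ convexHull ℝ (s ∩ face (convexHull ℝ s) u) := by
  intro x hx
  set C := convexHull ℝ (s ∩ face (convexHull ℝ s) u) with hC
  have hCeq : ∀ y ∈ C, ⟪y, u⟫ = ⟪x, u⟫ := by
    have hconv : Convex ℝ {y : RSpace n | ⟪y, u⟫ = ⟪x, u⟫} := by
      intro y hy z hz a b _ _ hab
      simp only [Set.mem_ofPred_eq] at hy hz ⊢
      rw [inner_add_left, real_inner_smul_left, real_inner_smul_left, hy, hz, ← add_mul, hab,
        one_mul]
    exact fun y hy => convexHull_min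
      (fun z hz => le_antisymm (hx.2 z hz.2.1) (hz.2.2 x hx.1)) hconv hy
  have hA : Convex ℝ (C ∪ {y : RSpace n | ⟪y, u⟫ < ⟪x, u⟫}) := by
    rw [convex_iff_forall_pos]
    intro y hy z hz a b ha hb hab
    have key : ⟪y, u⟫ ≤ ⟪x, u⟫ ∧ ⟪z, u⟫ ≤ ⟪x, u⟫ :=
      ⟨hy.elim (fun h => (hCeq y h).le) fun h => le_of_lt h,
        hz.elim (fun h => (hCeq z h).le) fun h => le_of_lt h⟩
    have hx1 : ⟪x, u⟫ = a * ⟪x, u⟫ + b * ⟪x, u⟫ := by rw [← add_mul, hab, one_mul]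
    by_cases hyz : y ∈ C ∧ z ∈ C
    · exact Or.inl (convex_convexHull ℝ _ hyz.1 hyz.2 ha.le hb.le hab)
    · right
      simp only [Set.mem_ofPred_eq, inner_add_left, real_inner_smul_left]
      rw [hx1]
      rcases not_and_or.1 hyz with h | h
      · exact add_lt_add_of_lt_of_le
          (mul_lt_mul_of_pos_left (hy.resolve_left h) ha) (mul_le_mul_of_nonneg_left key.2 hb.le)
      · exact add_lt_add_of_le_of_lt
          (mul_le_mul_of_nonneg_left key.1 ha.le) (mul_lt_mul_of_pos_left (hz.resolve_left h) hb)
  have hsub : s ⊆ C ∪ {y : RSpace n | ⟪y, u⟫ < ⟪x, u⟫} := by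
    intro y hy
    have hyP := subset_convexHull ℝ s hy
    rcases (hx.2 y hyP).lt_or_eq with h | h
    · exact Or.inr h
    · exact Or.inl (subset_convexHull ℝ _ ⟨hy, hyP, fun z hz => (hx.2 z hz).trans h.ge⟩)
  exact (convexHull_min hsub hA hx.1).resolve_right fun h => lt_irrefl ⟪x, u⟫ h

/-- A polytope has only finitely many facet normals. -/
theorem IsPolytope.finite_facetNormals {n : ℕ} {P : Set (RSpace n)} (hP : IsPolytope P) :
    (facetNormals P).Finite := by
  classical
  obtain ⟨s, -, rfl⟩ := hP
  set P := convexHull ℝ (s : Set (RSpace n)) with hPdef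
  let N : Finset (RSpace n) → Set (RSpace n) := fun t =>
    {u | ‖u‖ = 1 ∧ Module.finrank ℝ (vectorSpan ℝ (t : Set (RSpace n))) + 1 = n ∧
      u ∈ (vectorSpan ℝ (t : Set (RSpace n)))ᗮ}
  have hN : ∀ t, (N t).Finite := by
    intro t
    rcases (N t).eq_empty_or_nonempty with h | ⟨u₀, h1, h2, h3⟩
    · rw [h]; exact Set.finite_empty
    refine ((Set.finite_singleton (-u₀)).insert u₀).subset ?_
    rintro u ⟨hu1, -, hu3⟩
    have hfin : Module.finrank ℝ (vectorSpan ℝ (t : Set (RSpace n)))ᗮ = 1 := by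
      have := Submodule.finrank_add_finrank_orthogonal (vectorSpan ℝ (t : Set (RSpace n)))
      rw [finrank_euclideanSpace_fin] at this
      omega
    have hne : (⟨u₀, h3⟩ : (vectorSpan ℝ (t : Set (RSpace n)))ᗮ) ≠ 0 := by
      intro h
      have : u₀ = 0 := congrArg Subtype.val h
      simp [this] at h1
    obtain ⟨c, hc⟩ := (finrank_eq_one_iff_of_nonzero' _ hne).1 hfin ⟨u, hu3⟩
    have hc' : c • u₀ = u := congrArg Subtype.val hc
    have habs : |c| = 1 := by
      rw [← hc', norm_smul, h1, mul_one, Real.norm_eq_abs] at hu1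
      exact hu1
    rcases (abs_eq zero_le_one).1 habs with h | h
    · left; rw [← hc', h, one_smul]
    · right; rw [← hc', h, neg_one_smul, Set.mem_singleton_iff]
  refine (s.powerset.finite_toSet.biUnion fun t _ => hN t).subset ?_
  rintro u ⟨hu1, hu2⟩
  have hspan : vectorSpan ℝ ((s.filter fun y => y ∈ face P u : Finset (RSpace n)) :
      Set (RSpace n)) = vectorSpan ℝ (face P u) := by
    rw [Finset.coe_filter]
    apply le_antisymm
    · exact vectorSpan_mono ℝ fun y hy => hy.2
    · have h := vectorSpan_mono ℝ (face_convexHull_subset (s : Set (RSpace n)) u)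
      rw [← direction_affineSpan ℝ (convexHull ℝ _), affineSpan_convexHull,
        direction_affineSpan] at h
      exact h
  refine Set.mem_biUnion (x := s.filter fun y => y ∈ face P u)
    (Finset.mem_coe.2 (Finset.mem_powerset.2 (Finset.filter_subset _ _))) ⟨hu1, ?_, ?_⟩
  · rw [hspan]; exact hu2
  · rw [hspan, Submodule.mem_orthogonal]
    intro v hv
    rw [vectorSpan_def] at hv
    induction hv using Submodule.span_induction with
    | mem v hv =>
      obtain ⟨x, hx, y, hy, rfl⟩ := Set.mem_vsub.1 hv
      rw [vsub_eq_sub, inner_sub_left, sub_eq_zero]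
      exact le_antisymm (hy.2 x hx.1) (hx.2 y hy.1)
    | zero => exact inner_zero_left _
    | add v w _ _ hv hw => rw [inner_add_left, hv, hw, add_zero]
    | smul c v _ hv => rw [real_inner_smul_left, hv, mul_zero]

/-! Two facts carry the theorem. The first is uniqueness (`IsValuation.eq_of_eq_on_simplices`): a
valuation on polytopes containing the origin is determined by its values on simplices with a vertex
at the origin. If the difference `W` of two valuations vanishes on such simplices, cut a polytope by
hyperplanes through the origin. Both pieces and the section contain the origin, so `W` vanishes on
the whole once it vanishes on these three. To make this an induction, a polytope is written by
inequalities `a x ≤ 1` and `c x ≤ 0`; suitable cuts make constraints redundant until only simplices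
remain. The passage between vertices and inequalities is Weyl's theorem in one direction and
Krein–Milman in the other.

The second is the value of a contravariant valuation `Z` on the simplex `T` spanned by the origin
and a basis `b` (or part of one). Contravariance says that `⟪Z (φ P), φ x⟫ = ⟪Z P, x⟫` when `det φ =
1`. Shears that fix a lower-dimensional simplex, and for hyperplane sections also a reflection
composed with a transposition, force `Z` to vanish there. On a full simplex, even permutations of
the vertices make all `⟪Z T, b i⟫` equal, and the common value depends only on the volume of `T`;
call it `ζ`. Cutting `T` through a point of an edge shows that `ζ` is additive.

The facet vector is a valuation direction by direction (`facetTerm_add_facetTerm`), vanishes on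
lower-dimensional simplices, and pairs with every `b i` to `ζ` of the volume of `T`. By uniqueness
it equals `Z`. Its own contravariance also follows from uniqueness, without following facets through
a linear map. -/

/-! ### Polytopes as bounded intersections of half-spaces. -/

section Polyhedra

/-- A real number separates a finite set of lower bounds from a set of upper bounds. -/
theorem exists_between_of_finite {A B : Set ℝ} (hA : A.Finite) (h0 : (0 : ℝ) ∈ A)
    (h : ∀ a ∈ A, ∀ b ∈ B, a ≤ b) : ∃ t, (∀ a ∈ A, a ≤ t) ∧ ∀ b ∈ B, t ≤ b :=
  ⟨sSup A, fun _ ha => le_csSup hA.bddAbove ha, fun b hb => csSup_le ⟨0, h0⟩ fun a ha => h a ha b hb⟩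

/-- Fourier–Motzkin elimination of one generator of a cone. -/
theorem fourier_motzkin {F : Type*} [AddCommGroup F] [Module ℝ F]
    {L : Set (Module.Dual ℝ F)} (hL : L.Finite) (w : F) :
    ∃ L' : Set (Module.Dual ℝ F), L'.Finite ∧
      ∀ x, (∃ t : ℝ, 0 ≤ t ∧ ∀ l ∈ L, l (x - t • w) ≤ 0) ↔ ∀ l ∈ L', l x ≤ 0 := by
  -- Each `p` with `p w > 0` bounds `t` below by `p x / p w`, and each `q` with `q w < 0` bounds it
  -- above by `q x / q w`. The combinations compare these bounds pairwise; the unpaired `q` covers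
  -- the lower bound `0 ≤ t` and the case `q w = 0`.
  refine ⟨{q ∈ L | q w ≤ 0} ∪
    Set.image2 (fun p q : Module.Dual ℝ F => (p w) • q - (q w) • p)
      {p ∈ L | 0 < p w} {q ∈ L | q w < 0},
    (hL.sep _).union ((hL.sep _).image2 _ (hL.sep _)), fun x => ⟨?_, fun h => ?_⟩⟩
  · rintro ⟨t, ht, h⟩ l (⟨hl, hlw⟩ | ⟨p, ⟨hp, hpw⟩, q, ⟨hq, hqw⟩, rfl⟩)
    · have := h l hl
      simp only [map_sub, map_smul, smul_eq_mul] at this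
      nlinarith [mul_nonneg ht (neg_nonneg.2 hlw)]
    · have h1 := h p hp
      have h2 := h q hq
      simp only [map_sub, map_smul, smul_eq_mul] at h1 h2
      simp only [LinearMap.sub_apply, LinearMap.smul_apply, smul_eq_mul]
      nlinarith [mul_nonneg hpw.le (neg_nonneg.2 h2), mul_nonneg (neg_nonneg.2 hqw.le)
        (neg_nonneg.2 h1)]
  · obtain ⟨t, h1, h2⟩ := exists_between_of_finite
      (A := insert 0 ((fun p : Module.Dual ℝ F => p x / p w) '' {p ∈ L | 0 < p w}))
      (B := (fun q : Module.Dual ℝ F => q x / q w) '' {q ∈ L | q w < 0})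
      (((hL.sep _).image _).insert _) (Set.mem_insert _ _) (by
        rintro a (rfl | ⟨p, ⟨hp, hpw⟩, rfl⟩) b ⟨q, ⟨hq, hqw⟩, rfl⟩
        · exact div_nonneg_of_nonpos (h q (Or.inl ⟨hq, hqw.le⟩)) hqw.le
        · have := h _ (Or.inr ⟨p, ⟨hp, hpw⟩, q, ⟨hq, hqw⟩, rfl⟩)
          simp only [LinearMap.sub_apply, LinearMap.smul_apply, smul_eq_mul] at this
          simp only
          rw [div_le_iff₀ hpw, div_mul_eq_mul_div, le_div_iff_of_neg hqw]
          linarith)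
    refine ⟨t, h1 0 (Set.mem_insert _ _), fun l hl => ?_⟩
    simp only [map_sub, map_smul, smul_eq_mul]
    rcases lt_trichotomy (l w) 0 with hw | hw | hw
    · have := h2 _ ⟨l, ⟨hl, hw⟩, rfl⟩
      simp only at this
      rw [le_div_iff_of_neg hw] at this
      linarith
    · rw [hw, mul_zero, sub_zero]
      exact h l (Or.inl ⟨hl, hw.le⟩)
    · have := h1 _ (Set.mem_insert_of_mem _ ⟨l, ⟨hl, hw⟩, rfl⟩)
      simp only at this
      rw [div_le_iff₀ hw] at this
      linarith

/-- Weyl's theorem: finitely generated cones are polyhedral. -/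
theorem finitely_generated_cone_polyhedral {F ι : Type*} [AddCommGroup F] [Module ℝ F]
    [FiniteDimensional ℝ F] (g : ι → F) (s : Finset ι) :
    ∃ L : Set (Module.Dual ℝ F), L.Finite ∧
      ∀ x, (∃ t : ι → ℝ, (∀ i ∈ s, 0 ≤ t i) ∧ ∑ i ∈ s, t i • g i = x) ↔ ∀ l ∈ L, l x ≤ 0 := by
  classical
  induction s using Finset.induction_on with
  | empty =>
    let b := Module.finBasis ℝ F
    refine ⟨Set.range b.coord ∪ Set.range (fun i => -b.coord i),
      (Set.finite_range _).union (Set.finite_range _), fun x => ⟨?_, fun h => ⟨0, by simp, ?_⟩⟩⟩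
    · rintro ⟨t, -, rfl⟩ l -
      simp
    · rw [Finset.sum_empty]
      refine (b.ext_elem fun i => ?_)
      have h1 := h _ (Or.inl ⟨i, rfl⟩)
      have h2 := h _ (Or.inr ⟨i, rfl⟩)
      simp only [LinearMap.neg_apply, Module.Basis.coord_apply] at h1 h2
      simp only [map_zero, Finsupp.coe_zero, Pi.zero_apply]
      linarith
  | insert j s hj ih =>
    obtain ⟨L, hL, h⟩ := ih
    obtain ⟨L', hL', h'⟩ := fourier_motzkin hL (g j)
    refine ⟨L', hL', fun x => (Iff.trans ?_ (h' x))⟩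
    simp_rw [← h]
    constructor
    · rintro ⟨t, ht, rfl⟩
      refine ⟨t j, ht j (Finset.mem_insert_self _ _), t,
        fun i hi => ht i (Finset.mem_insert_of_mem hi), ?_⟩
      rw [Finset.sum_insert hj, add_sub_cancel_left]
    · rintro ⟨r, hr, t, ht, h⟩
      have hne : ∀ i ∈ s, i ≠ j := fun i hi hij => hj (hij ▸ hi)
      refine ⟨Function.update t j r, ?_, ?_⟩
      · intro i hi
        rcases Finset.mem_insert.1 hi with rfl | hi
        · simpa using hr
        · rw [Function.update_of_ne (hne i hi)]; exact ht i hi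
      · rw [Finset.sum_insert hj, Function.update_self, Finset.sum_congr rfl fun i hi => by
          rw [Function.update_of_ne (hne i hi)], h]
        abel

/-- The polyhedron containing the origin that is given by the inequalities `a x ≤ 1` for `a ∈ A`
and `c x ≤ 0` for `c ∈ C`. -/
def polyhedronO {E : Type*} [AddCommGroup E] [Module ℝ E] (A C : List (Module.Dual ℝ E)) : Set E :=
  {x | (∀ a ∈ A, a x ≤ 1) ∧ ∀ c ∈ C, c x ≤ 0}

/-- The convex hull of a finite set is a polyhedron as soon as it contains the origin. -/
theorem exists_convexHull_eq_polyhedronO {E : Type*} [AddCommGroup E] [Module ℝ E]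
    [FiniteDimensional ℝ E] (s : Finset E) (h0 : (0 : E) ∈ convexHull ℝ (s : Set E)) :
    ∃ A C : List (Module.Dual ℝ E), convexHull ℝ (s : Set E) = polyhedronO A C := by
  classical
  -- Homogenization: `x` lies in the hull exactly when `(x, 1)` lies in the cone over the points
  -- `(v, 1)`.
  obtain ⟨L, hL, h⟩ := finitely_generated_cone_polyhedral (fun v : E => (v, (1 : ℝ))) s
  have hmem : ∀ x, x ∈ convexHull ℝ (s : Set E) ↔ ∀ l ∈ L, l (x, 1) ≤ 0 := by
    intro x
    rw [← h, Finset.mem_convexHull']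
    refine exists_congr fun t => and_congr_right fun _ => ?_
    simp only [Prod.smul_mk, smul_eq_mul, mul_one, Prod.ext_iff, Prod.fst_sum, Prod.snd_sum]
    exact and_comm
  have hsplit : ∀ (l : Module.Dual ℝ (E × ℝ)) (x : E), l (x, 1) = l (x, 0) + l (0, 1) := by
    intro l x
    rw [← map_add]; simp
  have hle : ∀ l ∈ L, l (0, 1) ≤ 0 := (hmem 0).1 h0
  let inl := LinearMap.inl ℝ E ℝ
  -- Since the origin lies in the hull, every constant term `l (0, 1)` is nonpositive. The negative
  -- ones are normalized to give `a x ≤ 1`, the zero ones give `c x ≤ 0`.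
  refine ⟨(hL.toFinset.filter (fun l => l (0, 1) < 0)).toList.map
      (fun l => (-(l (0, 1)))⁻¹ • (l ∘ₗ inl)),
    (hL.toFinset.filter (fun l => l (0, 1) = 0)).toList.map (fun l => l ∘ₗ inl), ?_⟩
  ext x
  rw [hmem]
  simp only [polyhedronO, Set.mem_ofPred_eq, List.mem_map, Finset.mem_toList, Finset.mem_filter,
    Set.Finite.mem_toFinset, forall_exists_index, and_imp]
  constructor
  · intro hx
    constructor
    · rintro _ l hl hl0 rfl
      have := hx l hl
      rw [hsplit] at this
      simp only [LinearMap.smul_apply, smul_eq_mul, LinearMap.comp_apply, inl, LinearMap.inl_apply]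
      rw [inv_mul_le_iff₀ (by linarith)]
      linarith
    · rintro _ l hl hl0 rfl
      have := hx l hl
      rw [hsplit, hl0] at this
      simpa [inl] using this
  · rintro ⟨h1, h2⟩ l hl
    rw [hsplit]
    rcases (hle l hl).lt_or_eq with h | h
    · have := h1 _ l hl h rfl
      simp only [LinearMap.smul_apply, smul_eq_mul, LinearMap.comp_apply, inl,
        LinearMap.inl_apply] at this
      rw [inv_mul_le_iff₀ (by linarith)] at this
      linarith
    · have := h2 _ l hl h rfl
      simp only [LinearMap.comp_apply, inl, LinearMap.inl_apply] at this
      linarith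

/-- An extreme point of a polyhedron is determined by the constraints that are active there. -/
theorem finite_extremePoints_polyhedron {E ι : Type*} [AddCommGroup E] [Module ℝ E] [Finite ι]
    (l : ι → Module.Dual ℝ E) (b : ι → ℝ) :
    (Set.extremePoints ℝ {x | ∀ i, l i x ≤ b i}).Finite := by
  set P := {x | ∀ i, l i x ≤ b i} with hP
  refine Set.Finite.of_finite_image (f := fun x => {i | l i x = b i}) (Set.toFinite _) ?_
  intro x hx y hy hxy
  by_contra hne
  have hact : ∀ i, l i x = b i ↔ l i y = b i := fun i => Set.ext_iff.1 hxy i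
  -- Suppose `x ≠ y` have the same active constraints. These are constant along `x - y`, and `e` is
  -- small enough for the inactive ones to survive a move by `± e • (x - y)`. Then `x` is the
  -- midpoint of a segment in the polyhedron, so it is not extreme.
  obtain ⟨e, he, hsm⟩ : ∃ e : ℝ, 0 < e ∧ ∀ i, l i x < b i → e * |l i (x - y)| ≤ b i - l i x := by
    have hev : ∀ i, ∃ e : ℝ, 0 < e ∧ ∀ e' ≤ e, 0 < e' → l i x < b i →
        e' * |l i (x - y)| ≤ b i - l i x := by
      intro i
      by_cases h : l i x < b i
      · refine ⟨(b i - l i x) / (|l i (x - y)| + 1), by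
          have := sub_pos.2 h; positivity, fun e' he' hpos _ => ?_⟩
        have h1 : 0 ≤ |l i (x - y)| := abs_nonneg _
        rw [le_div_iff₀ (by positivity)] at he'
        nlinarith
      · exact ⟨1, one_pos, fun _ _ _ h' => absurd h' h⟩
    choose e he hh using hev
    have := Fintype.ofFinite ι
    rcases isEmpty_or_nonempty ι with hι | hι
    · exact ⟨1, one_pos, fun i => hι.elim i⟩
    · refine ⟨Finset.univ.inf' Finset.univ_nonempty e, ?_, fun i hi => ?_⟩
      · rw [Finset.lt_inf'_iff]; exact fun i _ => he i
      · exact hh i _ (Finset.inf'_le _ (Finset.mem_univ i))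
          (by rw [Finset.lt_inf'_iff]; exact fun i _ => he i) hi
  have hmem : ∀ s : ℝ, |s| = e → x + s • (x - y) ∈ P := by
    intro s hs i
    rcases (hx.1 i).lt_or_eq with h | h
    · have h1 := hsm i h
      have h2 : s * l i (x - y) ≤ e * |l i (x - y)| := by
        rw [← hs, ← abs_mul]; exact le_abs_self _
      rw [map_add, map_smul, smul_eq_mul]
      linarith
    · rw [map_add, map_smul, map_sub, h, (hact i).1 h, sub_self, smul_zero, add_zero]
  have h1 := hmem e (abs_of_pos he)
  have h2 := hmem (-e) (by rw [abs_neg, abs_of_pos he])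
  have h3 : x ∈ openSegment ℝ (x + e • (x - y)) (x + (-e) • (x - y)) := by
    refine ⟨1 / 2, 1 / 2, by norm_num, by norm_num, by norm_num, ?_⟩
    module
  have h4 := hx.2 h1 h2 h3
  have h5 : e • (x - y) = 0 := by simpa using h4
  rcases smul_eq_zero.1 h5 with h | h
  · exact he.ne' h
  · exact hne (sub_eq_zero.1 h)

/-- Bounded polyhedra are polytopes. -/
theorem isPolytope_polyhedronO {n : ℕ} (A C : List (Module.Dual ℝ (RSpace n)))
    (hb : Bornology.IsBounded (polyhedronO A C)) : IsPolytope (polyhedronO A C) := by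
  have heq : polyhedronO A C = {x | ∀ i : {a // a ∈ A} ⊕ {c // c ∈ C},
      (Sum.elim (fun a => a.1) (fun c => c.1) i : Module.Dual ℝ (RSpace n)) x ≤
        Sum.elim (fun _ => 1) (fun _ => 0) i} := by
    ext x
    simp [polyhedronO, Sum.forall]
  have : Finite {a // a ∈ A} := A.finite_toSet
  have : Finite {c // c ∈ C} := C.finite_toSet
  have hfin : (Set.extremePoints ℝ (polyhedronO A C)).Finite := by
    rw [heq]; exact finite_extremePoints_polyhedron _ _
  have hclosed : IsClosed (polyhedronO A C) := by
    rw [heq]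
    simp only [Set.ofPred_forall]
    exact isClosed_iInter fun i => isClosed_le
      (LinearMap.continuous_of_finiteDimensional _) continuous_const
  have hconv : Convex ℝ (polyhedronO A C) := by
    rw [heq]
    simp only [Set.ofPred_forall]
    exact convex_iInter fun i => convex_halfSpace_le (LinearMap.isLinear _) _
  have hcomp : IsCompact (polyhedronO A C) := Metric.isCompact_of_isClosed_isBounded hclosed hb
  have hkm := closure_convexHull_extremePoints hcomp hconv
  rw [(hfin.isClosed_convexHull ℝ).closure_eq] at hkm
  have h0 : (0 : RSpace n) ∈ polyhedronO A C := ⟨by simp, by simp⟩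
  refine ⟨hfin.toFinset, ?_, by rw [Set.Finite.coe_toFinset, hkm]⟩
  rw [Set.Finite.toFinset_nonempty, ← convexHull_nonempty_iff (𝕜 := ℝ), hkm]
  exact ⟨0, h0⟩

end Polyhedra

/-! ### Simplicial decomposition by hyperplanes through the origin. -/

section Uniqueness

/-- `W` vanishes on the polytope with underlying set `P`. -/
def VanishesOn {n : ℕ} (W : PolytopeO n → RSpace n) (P : Set (RSpace n)) : Prop :=
  ∀ U : PolytopeO n, U.1 = P → W U = 0

/-- The hyperplane `f = 0` passes through the origin, so both pieces and their intersection are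
again admissible polytopes and the valuation identity applies to them. -/
theorem VanishesOn.of_cut {n : ℕ} {W : PolytopeO n → RSpace n} (hW : IsValuation W)
    (f : Module.Dual ℝ (RSpace n)) {A C A₁ C₁ A₂ C₂ A₃ C₃ : List (Module.Dual ℝ (RSpace n))}
    (hb : Bornology.IsBounded (polyhedronO A C))
    (h₁ : polyhedronO A₁ C₁ = polyhedronO A C ∩ {x | f x ≤ 0})
    (h₂ : polyhedronO A₂ C₂ = polyhedronO A C ∩ {x | 0 ≤ f x})
    (h₃ : polyhedronO A₃ C₃ = polyhedronO A C ∩ {x | f x = 0})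
    (hv₁ : Bornology.IsBounded (polyhedronO A₁ C₁) → VanishesOn W (polyhedronO A₁ C₁))
    (hv₂ : Bornology.IsBounded (polyhedronO A₂ C₂) → VanishesOn W (polyhedronO A₂ C₂))
    (hv₃ : Bornology.IsBounded (polyhedronO A₃ C₃) → VanishesOn W (polyhedronO A₃ C₃)) :
    VanishesOn W (polyhedronO A C) := by
  intro U hU
  have hb₁ := hb.subset (h₁ ▸ Set.inter_subset_left : polyhedronO A₁ C₁ ⊆ _)
  have hb₂ := hb.subset (h₂ ▸ Set.inter_subset_left : polyhedronO A₂ C₂ ⊆ _)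
  have hb₃ := hb.subset (h₃ ▸ Set.inter_subset_left : polyhedronO A₃ C₃ ⊆ _)
  have h0 : ∀ A C : List (Module.Dual ℝ (RSpace n)), (0 : RSpace n) ∈ polyhedronO A C :=
    fun A C => ⟨by simp, by simp⟩
  let X₁ : PolytopeO n := ⟨_, isPolytope_polyhedronO _ _ hb₁, h0 _ _⟩
  let X₂ : PolytopeO n := ⟨_, isPolytope_polyhedronO _ _ hb₂, h0 _ _⟩
  let X₃ : PolytopeO n := ⟨_, isPolytope_polyhedronO _ _ hb₃, h0 _ _⟩
  have key := hW X₁ X₂ U X₃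
    (by
      change U.1 = polyhedronO A₁ C₁ ∪ polyhedronO A₂ C₂
      rw [hU, h₁, h₂, ← Set.inter_union_distrib_left, Set.inter_eq_left.2]
      exact fun x _ => le_total (f x) 0)
    (by
      change polyhedronO A₃ C₃ = polyhedronO A₁ C₁ ∩ polyhedronO A₂ C₂
      rw [h₁, h₂, h₃, ← Set.inter_inter_distrib_left]
      congr 1
      ext x
      exact le_antisymm_iff)
  rw [hv₁ hb₁ X₁ rfl, hv₂ hb₂ X₂ rfl, hv₃ hb₃ X₃ rfl, add_zero, add_zero] at key
  exact key.symm

/-- A bounded polyhedron has trivial recession cone. -/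
theorem eq_zero_of_recession {n : ℕ} {A C : List (Module.Dual ℝ (RSpace n))}
    (hb : Bornology.IsBounded (polyhedronO A C)) {y : RSpace n} (hA : ∀ a ∈ A, a y ≤ 0)
    (hC : ∀ c ∈ C, c y ≤ 0) : y = 0 := by
  obtain ⟨R, hR⟩ := hb.exists_norm_le
  by_contra hne
  have hpos : 0 < ‖y‖ := norm_pos_iff.2 hne
  have hR0 : 0 ≤ R := (norm_nonneg _).trans (hR 0 ⟨by simp, by simp⟩)
  have ht : 0 ≤ (R + 1) / ‖y‖ := by positivity
  have := hR (((R + 1) / ‖y‖) • y) ⟨fun a ha => by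
      rw [map_smul, smul_eq_mul]
      exact (mul_nonpos_of_nonneg_of_nonpos ht (hA a ha)).trans zero_le_one, fun c hc => by
      rw [map_smul, smul_eq_mul]
      exact mul_nonpos_of_nonneg_of_nonpos ht (hC c hc)⟩
  rw [norm_smul, Real.norm_of_nonneg ht, div_mul_cancel₀ _ hpos.ne'] at this
  linarith

/-- Cutting through the point `v` removes all but one of the constraints that are not active at
`v`. -/
theorem VanishesOn.of_apex {n : ℕ} {W : PolytopeO n → RSpace n} (hW : IsValuation W)
    (a : Module.Dual ℝ (RSpace n)) (C : List (Module.Dual ℝ (RSpace n)))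
    (S : Submodule ℝ (Module.Dual ℝ (RSpace n))) {v : RSpace n} (hav : a v = 1)
    (hC : ∀ c ∈ C, c v = 0)
    (hS : ∀ d D, d ∈ S → d v < 0 → (∀ e ∈ D, e ∈ S ∧ e v = 0) →
      Bornology.IsBounded (polyhedronO [a] (d :: C ++ D)) →
        VanishesOn W (polyhedronO [a] (d :: C ++ D)))
    (D₁ : List (Module.Dual ℝ (RSpace n))) :
    ∀ D₀ : List (Module.Dual ℝ (RSpace n)), (∀ d ∈ D₁, d ∈ S ∧ d v < 0) →
      (∀ d ∈ D₀, d ∈ S ∧ d v = 0) →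
      Bornology.IsBounded (polyhedronO [a] (D₁ ++ C ++ D₀)) →
        VanishesOn W (polyhedronO [a] (D₁ ++ C ++ D₀)) := by
  induction hlen : D₁.length generalizing D₁ with
  | zero =>
    intro D₀ h₁ h₀ hb
    obtain rfl : D₁ = [] := List.length_eq_zero_iff.1 hlen
    exfalso
    -- With no constraint strictly negative at `v`, the direction `-v` recedes to infinity inside
    -- the polyhedron.
    have : (-v) = 0 := eq_zero_of_recession hb (by simp [hav]) (by
      intro c hc
      rw [map_neg]
      rcases List.mem_append.1 hc with hc | hc
      · rw [hC c (by simpa using hc), neg_zero]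
      · rw [(h₀ c hc).2, neg_zero])
    rw [neg_eq_zero] at this
    rw [this, map_zero] at hav
    exact zero_ne_one hav
  | succ m ih =>
    intro D₀ h₁ h₀ hb
    match D₁, hlen with
    | [d], _ => exact hS d D₀ (h₁ d (by simp)).1 (h₁ d (by simp)).2 h₀ hb
    | d :: e :: D, hlen =>
      have hd := h₁ d (by simp)
      have he := h₁ e (by simp)
      have hD : ∀ d ∈ D, d ∈ S ∧ d v < 0 := fun d hd => h₁ d (by simp [hd])
      have hl : D.length + 1 = m := by simpa using hlen
      -- `f` is the combination of `d` and `e` that vanishes at `v`. As `d v` and `e v` are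
      -- negative, `e` implies `d` where `f ≤ 0`, and `d` implies `e` where `f ≥ 0`. Each piece
      -- loses a strict constraint and gains only ones vanishing at `v`.
      obtain ⟨f, hf⟩ : ∃ f, f = (-(e v)) • d + d v • e := ⟨_, rfl⟩
      have hfx : ∀ x, f x = -(e v) * d x + d v * e x := fun x => by simp [hf]
      have hfS : f ∈ S := hf ▸ S.add_mem (S.smul_mem _ hd.1) (S.smul_mem _ he.1)
      have hfv : f v = 0 := by rw [hfx]; ring
      refine VanishesOn.of_cut hW f hb (A₁ := [a]) (C₁ := (e :: D) ++ C ++ (f :: D₀))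
        (A₂ := [a]) (C₂ := (d :: D) ++ C ++ (-f :: D₀))
        (A₃ := [a]) (C₃ := (e :: D) ++ C ++ (f :: -f :: D₀)) ?_ ?_ ?_
        (ih (e :: D) (by simpa using hl) _ ?_ ?_) (ih (d :: D) (by simpa using hl) _ ?_ ?_)
        (ih (e :: D) (by simpa using hl) _ ?_ ?_)
      · ext x
        have h : f x ≤ 0 → e x ≤ 0 → d x ≤ 0 := fun h1 h2 => by
          rw [hfx] at h1; nlinarith
        simp only [polyhedronO, List.mem_append, List.mem_cons, Set.mem_ofPred_eq,
          Set.mem_inter_iff, or_imp, forall_and, forall_eq]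
        tauto
      · ext x
        have h : 0 ≤ f x → d x ≤ 0 → e x ≤ 0 := fun h1 h2 => by
          rw [hfx] at h1; nlinarith
        have h' : (-f) x ≤ 0 ↔ 0 ≤ f x := by simp
        simp only [polyhedronO, List.mem_append, List.mem_cons, Set.mem_ofPred_eq,
          Set.mem_inter_iff, or_imp, forall_and, forall_eq, h']
        tauto
      · ext x
        have h : f x ≤ 0 → e x ≤ 0 → d x ≤ 0 := fun h1 h2 => by
          rw [hfx] at h1; nlinarith
        have h' : (-f) x ≤ 0 ↔ 0 ≤ f x := by simp
        simp only [polyhedronO, List.mem_append, List.mem_cons, Set.mem_ofPred_eq,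
          Set.mem_inter_iff, or_imp, forall_and, forall_eq, h', le_antisymm_iff]
        tauto
      · rintro d' (_ | ⟨_, h⟩)
        exacts [he, hD _ ‹_›]
      · rintro d' (_ | ⟨_, h⟩)
        exacts [⟨hfS, hfv⟩, h₀ _ ‹_›]
      · rintro d' (_ | ⟨_, h⟩)
        exacts [hd, hD _ ‹_›]
      · rintro d' (_ | ⟨_, h⟩)
        exacts [⟨S.neg_mem hfS, by simp [hfv]⟩, h₀ _ ‹_›]
      · rintro d' (_ | ⟨_, h⟩)
        exacts [he, hD _ ‹_›]
      · rintro d' (_ | ⟨_, _ | ⟨_, h⟩⟩)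
        exacts [⟨hfS, hfv⟩, ⟨S.neg_mem hfS, by simp [hfv]⟩, h₀ _ ‹_›]

theorem mem_convexHull_insert_zero_range {E ι : Type*} [AddCommGroup E] [Module ℝ E] [Fintype ι]
    (v : ι → E) (x : E) : x ∈ convexHull ℝ (insert 0 (Set.range v)) ↔
      ∃ t : ι → ℝ, (∀ i, 0 ≤ t i) ∧ ∑ i, t i ≤ 1 ∧ ∑ i, t i • v i = x := by
  classical
  constructor
  · intro hx
    refine convexHull_min (t := {x | ∃ t : ι → ℝ, (∀ i, 0 ≤ t i) ∧ ∑ i, t i ≤ 1 ∧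
      ∑ i, t i • v i = x}) ?_ ?_ hx
    · rintro _ (rfl | ⟨i, rfl⟩)
      · exact ⟨0, by simp, by simp, by simp⟩
      · refine ⟨Pi.single i 1, fun j => ?_, by simp, ?_⟩
        · rw [Pi.single_apply]
          split_ifs <;> norm_num
        · simp [Pi.single_apply, ite_smul]
    · rintro _ ⟨t, ht, ht1, rfl⟩ _ ⟨s, hs, hs1, rfl⟩ p q hp hq hpq
      refine ⟨fun i => p * t i + q * s i, fun i => ?_, ?_, ?_⟩
      · have := ht i; have := hs i; positivity
      · rw [Finset.sum_add_distrib, ← Finset.mul_sum, ← Finset.mul_sum]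
        nlinarith
      · simp_rw [add_smul, mul_smul, Finset.sum_add_distrib, Finset.smul_sum]
  · rintro ⟨t, ht, ht1, rfl⟩
    have := (convex_convexHull ℝ (insert 0 (Set.range v))).sum_mem (t := Finset.univ)
      (w := fun o : Option ι => o.elim (1 - ∑ i, t i) t) (z := fun o : Option ι => o.elim 0 v)
      (by rintro (_ | i) _ <;> simp [ht, ht1]) (by simp [Fintype.sum_option])
      (by rintro (_ | i) _ <;> exact subset_convexHull ℝ _ (by simp))
    simpa [Fintype.sum_option] using this

theorem linearIndependent_of_dual {E : Type*} {k : ℕ} [AddCommGroup E] [Module ℝ E]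
    {c : Fin k → Module.Dual ℝ E} {v : Fin k → E} (hcv : ∀ i j, i ≠ j → c i (v j) = 0)
    (hne : ∀ i, c i (v i) ≠ 0) : LinearIndependent ℝ v := by
  rw [Fintype.linearIndependent_iff]
  intro g hg i
  have := congrArg (c i) hg
  rw [map_sum, Finset.sum_eq_single i (fun j _ hj => by rw [map_smul, hcv i j hj.symm, smul_zero])
    (by simp), map_zero, map_smul, smul_eq_mul] at this
  exact (mul_eq_zero.1 this).resolve_right (hne i)

/-- The main step of the simplicial decomposition: `v` collects vertices of a simplex, and `c` the
facets opposite to them. -/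
theorem VanishesOn.of_partial_simplex {n : ℕ} {W : PolytopeO n → RSpace n} (hW : IsValuation W)
    (hsimp : ∀ V : Set (RSpace n), LinearIndepOn ℝ id V →
      VanishesOn W (convexHull ℝ (insert 0 V)))
    (a : Module.Dual ℝ (RSpace n)) (m : ℕ) :
    ∀ (k : ℕ), k + m = n + 1 → ∀ (c : Fin k → Module.Dual ℝ (RSpace n)) (v : Fin k → RSpace n),
      (∀ i j, i ≠ j → c i (v j) = 0) → (∀ i, c i (v i) < 0) → (∀ i, a (v i) = 1) →
      ∀ D : List (Module.Dual ℝ (RSpace n)), (∀ d ∈ D, ∀ i, d (v i) = 0) →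
      Bornology.IsBounded (polyhedronO [a] (List.ofFn c ++ D)) →
        VanishesOn W (polyhedronO [a] (List.ofFn c ++ D)) := by
  induction m with
  | zero =>
    intro k hk c v hcv hneg
    have hli : LinearIndependent ℝ v := linearIndependent_of_dual hcv fun i => (hneg i).ne
    have := hli.fintype_card_le_finrank
    rw [finrank_euclideanSpace_fin, Fintype.card_fin] at this
    omega
  | succ m ih =>
    intro k hk c v hcv hneg ha D hD hb
    -- Such an `x` serves as the next vertex. Cutting through it leaves a single constraint that is
    -- strict at `x`, which becomes the facet opposite to `x`; membership in `S` makes it vanish at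
    -- the earlier vertices. Without such an `x`, the polyhedron is already the simplex spanned by
    -- the origin and the `v i`.
    by_cases hex : ∃ x, a x = 1 ∧ (∀ i, c i x = 0) ∧ ∀ d ∈ D, d x ≤ 0
    · obtain ⟨x, hax, hcx, hDx⟩ := hex
      let S : Submodule ℝ (Module.Dual ℝ (RSpace n)) :=
        { carrier := {d | ∀ i, d (v i) = 0}
          add_mem' := fun {d e} hd he i => by simp [hd i, he i]
          zero_mem' := fun i => by simp
          smul_mem' := fun r d hd i => by simp [hd i] }
      have hset : polyhedronO [a] (List.ofFn c ++ D) =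
          polyhedronO [a] (D.filter (fun d => d x < 0) ++ List.ofFn c ++
            D.filter (fun d => d x = 0)) := by
        ext y
        simp only [polyhedronO, List.mem_append, List.mem_filter, Set.mem_ofPred_eq,
          decide_eq_true_eq]
        refine and_congr_right fun _ => forall_congr' fun d => imp_congr_left ?_
        have := fun hd => (hDx d hd).lt_or_eq
        tauto
      rw [hset] at hb ⊢
      refine VanishesOn.of_apex hW a (List.ofFn c) S hax (by simpa using hcx) ?_ _ _ ?_ ?_ hb
      · intro d D' hdS hdx hD' hb'
        have hset' : polyhedronO [a] (d :: List.ofFn c ++ D') =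
            polyhedronO [a] (List.ofFn (Fin.cons d c : Fin (k + 1) → _) ++ D') := by
          rw [List.ofFn_cons]
        rw [hset'] at hb' ⊢
        refine ih (k + 1) (by omega) (Fin.cons d c) (Fin.cons x v) ?_ ?_ ?_ D' ?_ hb'
        · intro i j
          induction i using Fin.cases <;> induction j using Fin.cases <;> simp [hcx]
          · intro _
            exact hdS _
          · intro h; exact hcv _ _ h
        · intro i
          induction i using Fin.cases <;> simp [hdx, hneg]
        · intro i
          induction i using Fin.cases <;> simp [hax, ha]
        · intro e he i
          induction i using Fin.cases
          · simpa using (hD' e he).2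
          · simpa using (hD' e he).1 _
      · intro d hd
        simp only [List.mem_filter, decide_eq_true_eq] at hd
        exact ⟨hD d hd.1, hd.2⟩
      · intro d hd
        simp only [List.mem_filter, decide_eq_true_eq] at hd
        exact ⟨hD d hd.1, hd.2⟩
    · have hli : LinearIndependent ℝ v := linearIndependent_of_dual hcv fun i => (hneg i).ne
      have hset : polyhedronO [a] (List.ofFn c ++ D) = convexHull ℝ (insert 0 (Set.range v)) := by
        ext x
        rw [mem_convexHull_insert_zero_range]
        constructor
        · rintro ⟨hxa, hxc⟩
          have hxc' : ∀ i, c i x ≤ 0 := fun i => hxc _ (by simp)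
          have hxD : ∀ d ∈ D, d x ≤ 0 := fun d hd => hxc _ (by simp [hd])
          -- These are the coordinates that `x` must have. The remainder `x - ∑ t j • v j` is killed
          -- by all `c i` and satisfies `D`. If `a` were positive on it, rescaling would contradict
          -- the failure of `hex`; so it is a recession direction, hence zero.
          obtain ⟨t, ht⟩ : ∃ t : Fin k → ℝ, t = fun i => c i x / c i (v i) := ⟨_, rfl⟩
          have hcs : ∀ i, c i (∑ j, t j • v j) = c i x := by
            intro i
            rw [map_sum, Finset.sum_eq_single i (fun j _ hj => by
              rw [map_smul, hcv i j hj.symm, smul_zero]) (by simp), map_smul, smul_eq_mul, ht,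
              div_mul_cancel₀ _ (hneg i).ne]
          have hds : ∀ d ∈ D, d (∑ j, t j • v j) = 0 := by
            intro d hd
            rw [map_sum]
            exact Finset.sum_eq_zero fun j _ => by rw [map_smul, hD d hd j, smul_zero]
          have has : a (∑ j, t j • v j) = ∑ j, t j := by
            rw [map_sum]
            exact Finset.sum_congr rfl fun j _ => by rw [map_smul, ha j, smul_eq_mul, mul_one]
          have hle : a (x - ∑ j, t j • v j) ≤ 0 := by
            by_contra! hpos
            refine hex ⟨(a (x - ∑ j, t j • v j))⁻¹ • (x - ∑ j, t j • v j), ?_, fun i => ?_,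
              fun d hd => ?_⟩
            · rw [map_smul, smul_eq_mul, inv_mul_cancel₀ hpos.ne']
            · rw [map_smul, map_sub (c i), hcs, sub_self, smul_zero]
            · rw [map_smul, map_sub d, hds d hd, sub_zero, smul_eq_mul]
              exact mul_nonpos_of_nonneg_of_nonpos (inv_nonneg.2 hpos.le) (hxD d hd)
          have h0 := eq_zero_of_recession hb (y := x - ∑ j, t j • v j) (by simpa using hle) (by
            intro d hd
            rcases List.mem_append.1 hd with hd | hd
            · obtain ⟨i, rfl⟩ := (List.mem_ofFn' _ _).1 hd
              rw [map_sub, hcs, sub_self]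
            · rw [map_sub, hds d hd, sub_zero]
              exact hxD d hd)
          rw [sub_eq_zero] at h0
          refine ⟨t, fun i => ?_, ?_, h0.symm⟩
          · rw [ht]
            exact div_nonneg_of_nonpos (hxc' i) (hneg i).le
          · rw [← has, ← h0]
            exact hxa a (by simp)
        · rintro ⟨t, ht, ht1, rfl⟩
          refine ⟨fun a' ha' => ?_, fun d hd => ?_⟩
          · rw [List.mem_singleton.1 ha', map_sum]
            simpa [ha] using ht1
          · rw [map_sum]
            rcases List.mem_append.1 hd with hd | hd
            · obtain ⟨i, rfl⟩ := (List.mem_ofFn' _ _).1 hd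
              refine Finset.sum_nonpos fun j _ => ?_
              rw [map_smul, smul_eq_mul]
              rcases eq_or_ne i j with rfl | hij
              · exact mul_nonpos_of_nonneg_of_nonpos (ht i) (hneg i).le
              · rw [hcv i j hij, mul_zero]
            · refine Finset.sum_nonpos fun j _ => ?_
              rw [map_smul, hD d hd, smul_zero]
      rw [hset]
      exact hsimp _ hli.linearIndepOn_id

/-- A cut along `a = b` makes one of `a x ≤ 1`, `b x ≤ 1` redundant in each piece, which leaves a
single inhomogeneous constraint. `VanishesOn.of_partial_simplex` then starts with no vertices. -/
theorem VanishesOn.of_polyhedronO {n : ℕ} {W : PolytopeO n → RSpace n} (hW : IsValuation W)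
    (hsimp : ∀ V : Set (RSpace n), LinearIndepOn ℝ id V →
      VanishesOn W (convexHull ℝ (insert 0 V)))
    (A : List (Module.Dual ℝ (RSpace n))) :
    ∀ C : List (Module.Dual ℝ (RSpace n)), Bornology.IsBounded (polyhedronO A C) →
      VanishesOn W (polyhedronO A C) := by
  have hone : ∀ a C, Bornology.IsBounded (polyhedronO [a] C) →
      VanishesOn W (polyhedronO [a] C) := fun a C hb =>
    VanishesOn.of_partial_simplex hW hsimp a (n + 1) 0 (zero_add _) Fin.elim0 Fin.elim0
      (fun i => i.elim0) (fun i => i.elim0) (fun i => i.elim0) C (fun _ _ i => i.elim0)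
      (by simpa using hb)
  induction hlen : A.length generalizing A with
  | zero =>
    intro C hb
    obtain rfl : A = [] := List.length_eq_zero_iff.1 hlen
    -- The trivial constraint `0 ≤ 1` brings the empty list into the one-constraint case.
    have : polyhedronO [] C = polyhedronO [0] C := by simp [polyhedronO]
    rw [this] at hb ⊢
    exact hone _ _ hb
  | succ m ih =>
    intro C hb
    match A, hlen with
    | [a], _ => exact hone a C hb
    | a :: b :: A, hlen =>
      have hl : A.length + 1 = m := by simpa using hlen
      refine VanishesOn.of_cut hW (a - b) hb (A₁ := b :: A) (C₁ := (a - b) :: C)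
        (A₂ := a :: A) (C₂ := (b - a) :: C) (A₃ := b :: A) (C₃ := (a - b) :: (b - a) :: C)
        ?_ ?_ ?_ (ih _ (by simpa using hl) _) (ih _ (by simpa using hl) _)
        (ih _ (by simpa using hl) _)
      all_goals
        ext x
        have h₁ : a x ≤ b x → b x ≤ 1 → a x ≤ 1 := le_trans
        have h₂ : b x ≤ a x → a x ≤ 1 → b x ≤ 1 := le_trans
        simp only [polyhedronO, List.mem_cons, Set.mem_ofPred_eq, Set.mem_inter_iff, or_imp,
          forall_and, forall_eq, LinearMap.sub_apply, sub_nonpos, sub_nonneg,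
          le_antisymm_iff]
        tauto

/-- A valuation on polytopes containing the origin is determined by its values on the simplices
with one vertex at the origin. -/
theorem IsValuation.eq_of_eq_on_simplices {n : ℕ} {Z Z' : PolytopeO n → RSpace n}
    (hZ : IsValuation Z) (hZ' : IsValuation Z')
    (h : ∀ V : Set (RSpace n), LinearIndepOn ℝ id V → ∀ U : PolytopeO n,
      U.1 = convexHull ℝ (insert 0 V) → Z U = Z' U) : Z = Z' := by
  have hW : IsValuation (fun P => Z P - Z' P) := by
    intro P Q U I hU hI
    have h₁ := hZ P Q U I hU hI
    have h₂ := hZ' P Q U I hU hI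
    simp only
    rw [sub_add_sub_comm, h₁, h₂, sub_add_sub_comm]
  funext P
  obtain ⟨⟨s, hs, hP⟩, h0⟩ := P.2
  rw [hP] at h0
  obtain ⟨A, C, hAC⟩ := exists_convexHull_eq_polyhedronO s h0
  refine sub_eq_zero.1 (VanishesOn.of_polyhedronO hW
    (fun V hV U hU => sub_eq_zero.2 (h V hV U hU)) A C ?_ P (hP.trans hAC))
  rw [← hAC]
  exact (s.finite_toSet.isCompact_convexHull ℝ).isBounded

end Uniqueness

/-! ### The facet vector is a valuation. -/

section FacetVectorValuation

theorem IsCauchySolution.map_zero {ζ : ℝ≥0 → ℝ} (hζ : IsCauchySolution ζ) : ζ 0 = 0 := by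
  have := hζ 0 0
  rw [add_zero] at this
  linarith

/-- The contribution of the direction `u` to the facet vector. -/
noncomputable def facetTerm {n : ℕ} (ζ : ℝ≥0 → ℝ) (P : Set (RSpace n)) (u : RSpace n) : RSpace n :=
  (ζ (coneVolume P u) / |supportFn P u|) • u

theorem IsPolytope.inner_le_supportFn {n : ℕ} {P : Set (RSpace n)} (hP : IsPolytope P)
    {x : RSpace n} (hx : x ∈ P) (u : RSpace n) : ⟪x, u⟫ ≤ supportFn P u :=
  (hP.isGreatest_supportFn u).2 ⟨x, hx, rfl⟩

theorem IsPolytope.supportFn_nonneg {n : ℕ} {P : Set (RSpace n)} (hP : IsPolytope P)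
    (h0 : (0 : RSpace n) ∈ P) (u : RSpace n) : 0 ≤ supportFn P u := by
  simpa using hP.inner_le_supportFn h0 u

theorem IsPolytope.face_eq {n : ℕ} {P : Set (RSpace n)} (hP : IsPolytope P) (u : RSpace n) :
    face P u = {x ∈ P | ⟪x, u⟫ = supportFn P u} := by
  obtain ⟨y, hy, hyu⟩ := (hP.isGreatest_supportFn u).1
  ext x
  refine and_congr_right fun hx => ⟨fun h => ?_, fun h z hz => ?_⟩
  · exact le_antisymm (hP.inner_le_supportFn hx u) (hyu ▸ h y hy)
  · rw [h]; exact hP.inner_le_supportFn hz u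

theorem IsPolytope.supportFn_eq {n : ℕ} {P : Set (RSpace n)} (hP : IsPolytope P) {u x : RSpace n}
    (hx : x ∈ P) (h : ∀ y ∈ P, ⟪y, u⟫ ≤ ⟪x, u⟫) : supportFn P u = ⟪x, u⟫ :=
  (hP.isGreatest_supportFn u).unique ⟨⟨x, hx, rfl⟩, by rintro _ ⟨y, hy, rfl⟩; exact h y hy⟩

theorem IsPolytope.convex {n : ℕ} {P : Set (RSpace n)} (hP : IsPolytope P) : Convex ℝ P := by
  obtain ⟨s, -, rfl⟩ := hP
  exact convex_convexHull ℝ _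

theorem IsPolytope.isClosed {n : ℕ} {P : Set (RSpace n)} (hP : IsPolytope P) : IsClosed P := by
  obtain ⟨s, -, rfl⟩ := hP
  exact s.finite_toSet.isClosed_convexHull ℝ

theorem IsPolytope.face_nonempty {n : ℕ} {P : Set (RSpace n)} (hP : IsPolytope P)
    (u : RSpace n) : (face P u).Nonempty := by
  obtain ⟨y, hy, hyu⟩ := (hP.isGreatest_supportFn u).1
  rw [hP.face_eq]
  exact ⟨y, hy, hyu⟩

theorem IsPolytope.convex_face {n : ℕ} {P : Set (RSpace n)} (hP : IsPolytope P)
    (u : RSpace n) : Convex ℝ (face P u) := by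
  rw [hP.face_eq]
  have hlin : IsLinearMap ℝ fun x : RSpace n => ⟪x, u⟫ :=
    ⟨fun x y => inner_add_left _ _ _, fun c x => real_inner_smul_left _ _ _⟩
  exact hP.convex.inter (convex_hyperplane hlin _)

theorem IsPolytope.isClosed_face {n : ℕ} {P : Set (RSpace n)} (hP : IsPolytope P)
    (u : RSpace n) : IsClosed (face P u) := by
  rw [hP.face_eq]
  exact hP.isClosed.inter (isClosed_eq (by fun_prop) continuous_const)

theorem volume_eq_zero_of_subset_submodule {n : ℕ} {S : Set (RSpace n)}
    {p : Submodule ℝ (RSpace n)} (hS : S ⊆ p) (hp : p ≠ ⊤) : MeasureTheory.volume S = 0 :=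
  MeasureTheory.measure_mono_null hS (MeasureTheory.Measure.addHaar_submodule _ p hp)

/-- If the facet's affine hull contains the origin, the support value is zero and division by zero
returns zero. If the face is not a facet, its cone lies in a proper subspace and `ζ 0 = 0`. Hence
facet vectors can be summed over any larger finite set of unit vectors, in particular over one
common to several polytopes. -/
theorem facetTerm_eq_zero {n : ℕ} {ζ : ℝ≥0 → ℝ} (hζ : IsCauchySolution ζ) {P : Set (RSpace n)}
    (hP : IsPolytope P) {u : RSpace n} (hu : ‖u‖ = 1)
    (hN : u ∉ facetNormals P \ facetNormalsO P) : facetTerm ζ P u = 0 := by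
  unfold facetTerm
  by_cases h0 : supportFn P u = 0
  · simp [h0]
  have hface := hP.face_eq u
  by_cases hun : u ∈ facetNormals P
  · exfalso
    have ho : u ∈ facetNormalsO P := by
      by_contra h; exact hN ⟨hun, h⟩
    have hsub : face P u ⊆ (AffineSubspace.mk' (supportFn P u • u) (ℝ ∙ u)ᗮ : Set (RSpace n)) := by
      intro x hx
      rw [hface] at hx
      rw [SetLike.mem_coe, AffineSubspace.mem_mk', vsub_eq_sub,
        Submodule.mem_orthogonal_singleton_iff_inner_left, inner_sub_left, hx.2,
        real_inner_smul_left, real_inner_self_eq_norm_sq, hu]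
      ring
    have := affineSpan_le.2 hsub ho.2
    rw [AffineSubspace.mem_mk', vsub_eq_sub,
        Submodule.mem_orthogonal_singleton_iff_inner_left, inner_sub_left, inner_zero_left,
        real_inner_smul_left, real_inner_self_eq_norm_sq, hu] at this
    apply h0
    linarith
  · have hvol : MeasureTheory.volume (convexHull ℝ (insert 0 (face P u))) = 0 := by
      obtain ⟨x₀, hx₀⟩ := hP.face_nonempty u
      have hle : vectorSpan ℝ (face P u) ≤ (ℝ ∙ u)ᗮ := by
        rw [vectorSpan_def, Submodule.span_le]
        rintro _ ⟨x, hx, y, hy, rfl⟩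
        rw [hface] at hx hy
        rw [SetLike.mem_coe, Submodule.mem_orthogonal_singleton_iff_inner_left]
        change ⟪x - y, u⟫ = 0
        rw [inner_sub_left, hx.2, hy.2, sub_self]
      have hu0 : u ≠ 0 := by rintro rfl; simp at hu
      have hfin : Module.finrank ℝ (vectorSpan ℝ (face P u)) + 1 ≤ n := by
        have h1 := Submodule.finrank_mono hle
        have h2 := Submodule.finrank_add_finrank_orthogonal (ℝ ∙ u)
        rw [finrank_euclideanSpace_fin, finrank_span_singleton hu0] at h2
        omega
      have hlt : Module.finrank ℝ (vectorSpan ℝ (face P u)) + 1 < n :=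
        lt_of_le_of_ne hfin fun h => hun ⟨hu, h⟩
      refine volume_eq_zero_of_subset_submodule (p := vectorSpan ℝ (face P u) ⊔ (ℝ ∙ x₀)) ?_ ?_
      · refine convexHull_min ?_ (Submodule.convex _)
        rintro x (rfl | hx)
        · exact Submodule.zero_mem _
        · rw [← sub_add_cancel x x₀]
          exact Submodule.add_mem_sup (vsub_mem_vectorSpan ℝ hx hx₀)
            (Submodule.mem_span_singleton_self _)
      · intro htop
        have hn := finrank_euclideanSpace_fin (𝕜 := ℝ) (n := n)
        rw [← finrank_top, ← htop] at hn
        refine hn.not_lt (lt_of_le_of_lt ?_ hlt)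
        refine (Submodule.finrank_add_le_finrank_add_finrank _ _).trans ?_
        gcongr
        exact (finrank_span_le_card ({x₀} : Set (RSpace n))).trans (by simp)
    rw [coneVolume, hvol, ENNReal.toNNReal_zero, hζ.map_zero, zero_div, zero_smul]

theorem facetVector_eq_sum {n : ℕ} {ζ : ℝ≥0 → ℝ} (hζ : IsCauchySolution ζ) {P : Set (RSpace n)}
    (hP : IsPolytope P) {N : Finset (RSpace n)} (hN : ∀ u ∈ N, ‖u‖ = 1)
    (hPN : ∀ u, ‖u‖ = 1 → u ∉ N → facetTerm ζ P u = 0) :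
    facetVector ζ P = ∑ u ∈ N, facetTerm ζ P u := by
  rw [facetVector, ← finsum_mem_coe_finset]
  change ∑ᶠ u ∈ facetNormals P \ facetNormalsO P, facetTerm ζ P u = _
  refine finsum_mem_inter_support_eq' _ _ _ fun u hu => ?_
  constructor
  · intro h
    by_contra h'
    exact hu (hPN u h.1.1 h')
  · intro h
    by_contra h'
    exact hu (facetTerm_eq_zero hζ hP (hN u h) h')

theorem mem_convexHull_insert_zero {n : ℕ} {F : Set (RSpace n)} (hF : Convex ℝ F)
    (hne : F.Nonempty) (x : RSpace n) :
    x ∈ convexHull ℝ (insert 0 F) ↔ ∃ t : ℝ, 0 ≤ t ∧ t ≤ 1 ∧ ∃ y ∈ F, t • y = x := by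
  rw [convexHull_insert hne, hF.convexHull_eq, mem_convexJoin]
  simp only [Set.mem_singleton_iff, exists_eq_left, segment_eq_image, Set.mem_image,
    Set.mem_Icc, smul_zero, zero_add]
  grind

/-- The pointwise form of the valuation property of the facet vector. -/
theorem facetTerm_add_facetTerm {n : ℕ} {ζ : ℝ≥0 → ℝ} (hζ : IsCauchySolution ζ)
    {P Q : Set (RSpace n)} (hP : IsPolytope P) (hQ : IsPolytope Q) (hU : IsPolytope (P ∪ Q))
    (hI : IsPolytope (P ∩ Q)) (h0 : (0 : RSpace n) ∈ P ∩ Q) (u : RSpace n) :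
    facetTerm ζ P u + facetTerm ζ Q u = facetTerm ζ (P ∪ Q) u + facetTerm ζ (P ∩ Q) u := by
  wlog hle : supportFn P u ≤ supportFn Q u generalizing P Q
  · rw [add_comm, Set.union_comm, Set.inter_comm]
    exact this hQ hP (by rwa [Set.union_comm]) (by rwa [Set.inter_comm])
      (by rwa [Set.inter_comm]) (le_of_not_ge hle)
  have hUs : supportFn (P ∪ Q) u = supportFn Q u := by
    obtain ⟨y, hy, hyu⟩ := (hQ.isGreatest_supportFn u).1
    simp only at hyu
    rw [← hyu]
    refine hU.supportFn_eq (Or.inr hy) ?_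
    rintro z (hz | hz)
    · exact (hP.inner_le_supportFn hz u).trans (hle.trans_eq hyu.symm)
    · exact (hQ.inner_le_supportFn hz u).trans_eq hyu.symm
  rcases hle.lt_or_eq with hlt | heq
  · have hUf : face (P ∪ Q) u = face Q u := by
      rw [hU.face_eq, hQ.face_eq, hUs]
      ext x
      constructor
      · rintro ⟨hx | hx, hxu⟩
        · exact absurd (hP.inner_le_supportFn hx u) (by rw [hxu]; exact not_le.2 hlt)
        · exact ⟨hx, hxu⟩
      · exact fun hx => ⟨Or.inr hx.1, hx.2⟩
    -- Points just off `x` on the segment towards the top face of `Q` lie in the convex union but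
    -- above `P`, hence in `Q`; let them tend to `x`. So the terms of `P` and `Q` reappear as those
    -- of the intersection and the union.
    have hsub : face P u ⊆ Q := by
      intro x hx
      rw [hP.face_eq] at hx
      obtain ⟨y, hy, hyu⟩ := (hQ.isGreatest_supportFn u).1
      simp only at hyu
      have hmem : ∀ t : ℝ, 0 < t → t ≤ 1 → x + t • (y - x) ∈ Q := by
        intro t ht ht1
        have : x + t • (y - x) ∈ P ∪ Q := by
          exact hU.convex.add_smul_sub_mem (Or.inl hx.1) (Or.inr hy) ⟨ht.le, ht1⟩
        refine this.resolve_left fun h => ?_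
        have := hP.inner_le_supportFn h u
        rw [inner_add_left, real_inner_smul_left, inner_sub_left, hx.2, hyu] at this
        nlinarith
      have hlim : Filter.Tendsto (fun t : ℝ => x + t • (y - x)) (nhdsWithin 0 (Set.Ioi 0))
          (nhds x) := by
        have : Continuous fun t : ℝ => x + t • (y - x) := by fun_prop
        have h := this.tendsto 0
        rw [zero_smul, add_zero] at h
        exact h.mono_left nhdsWithin_le_nhds
      refine hQ.isClosed.mem_of_tendsto hlim ?_
      filter_upwards [Ioc_mem_nhdsGT (zero_lt_one' ℝ)] with t ht
      exact hmem t ht.1 ht.2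
    have hIs : supportFn (P ∩ Q) u = supportFn P u := by
      obtain ⟨x, hx⟩ := hP.face_nonempty u
      have hx' := hx
      rw [hP.face_eq] at hx'
      rw [← hx'.2]
      exact hI.supportFn_eq ⟨hx.1, hsub hx⟩ fun y hy => hx.2 y hy.1
    have hIf : face (P ∩ Q) u = face P u := by
      rw [hI.face_eq, hIs]
      ext x
      constructor
      · rintro ⟨hx, hxu⟩
        rw [hP.face_eq]
        exact ⟨hx.1, hxu⟩
      · intro hx
        refine ⟨⟨hx.1, hsub hx⟩, ?_⟩
        rw [hP.face_eq] at hx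
        exact hx.2
    rw [add_comm]
    simp only [facetTerm, coneVolume, hUs, hUf, hIs, hIf]
  · have hUf : face (P ∪ Q) u = face P u ∪ face Q u := by
      rw [hU.face_eq, hQ.face_eq, hP.face_eq, hUs, heq]
      ext x
      simp only [Set.mem_union, Set.mem_ofPred_eq, or_and_right]
    -- The top face of the union is convex, hence connected, so it is not a disjoint union of two
    -- nonempty closed sets.
    have hne : (face P u ∩ face Q u).Nonempty := by
      have hpre := (hU.convex_face u).isPreconnected
      rw [hUf, isPreconnected_closed_iff] at hpre
      have := hpre _ _ (hP.isClosed_face u) (hQ.isClosed_face u) subset_rfl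
        (by rw [Set.inter_eq_right.2 Set.subset_union_left]; exact hP.face_nonempty u)
        (by rw [Set.inter_eq_right.2 Set.subset_union_right]; exact hQ.face_nonempty u)
      exact this.mono Set.inter_subset_right
    have hIs : supportFn (P ∩ Q) u = supportFn Q u := by
      obtain ⟨x, hxP, hxQ⟩ := hne
      have hx' := hxQ
      rw [hQ.face_eq] at hx'
      rw [← hx'.2]
      exact hI.supportFn_eq ⟨hxP.1, hxQ.1⟩ fun y hy => hxP.2 y hy.1
    have hIf : face (P ∩ Q) u = face P u ∩ face Q u := by
      rw [hI.face_eq, hQ.face_eq, hP.face_eq, hIs, heq]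
      ext x
      simp only [Set.mem_inter_iff, Set.mem_ofPred_eq]
      tauto
    simp only [facetTerm, hUs, hIs, heq, ← add_smul, ← add_div]
    by_cases hz : supportFn Q u = 0
    · simp [hz]
    rw [← hζ, ← hζ]
    congr 3
    have hht : ∀ {x}, x ∈ face P u ∨ x ∈ face Q u → ⟪x, u⟫ = supportFn Q u := by
      intro x hx
      rw [hP.face_eq, hQ.face_eq, heq] at hx
      rcases hx with hx | hx <;> exact hx.2
    have hcU : convexHull ℝ (insert 0 (face (P ∪ Q) u)) =
        convexHull ℝ (insert 0 (face P u)) ∪ convexHull ℝ (insert 0 (face Q u)) := by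
      ext x
      rw [Set.mem_union, mem_convexHull_insert_zero (hU.convex_face u) (hU.face_nonempty u),
        mem_convexHull_insert_zero (hP.convex_face u) (hP.face_nonempty u),
        mem_convexHull_insert_zero (hQ.convex_face u) (hQ.face_nonempty u), hUf]
      simp only [Set.mem_union]
      grind
    have hcI : convexHull ℝ (insert 0 (face (P ∩ Q) u)) =
        convexHull ℝ (insert 0 (face P u)) ∩ convexHull ℝ (insert 0 (face Q u)) := by
      ext x
      rw [Set.mem_inter_iff, mem_convexHull_insert_zero (hI.convex_face u) (hI.face_nonempty u),
        mem_convexHull_insert_zero (hP.convex_face u) (hP.face_nonempty u),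
        mem_convexHull_insert_zero (hQ.convex_face u) (hQ.face_nonempty u), hIf]
      constructor
      · rintro ⟨t, ht, ht1, y, hy, rfl⟩
        exact ⟨⟨t, ht, ht1, y, hy.1, rfl⟩, ⟨t, ht, ht1, y, hy.2, rfl⟩⟩
      · rintro ⟨⟨t, ht, ht1, y, hy, rfl⟩, ⟨s, hs, hs1, z, hz', hzy⟩⟩
        have h := congrArg (fun x => ⟪x, u⟫) hzy
        simp only [real_inner_smul_left, hht (Or.inl hy), hht (Or.inr hz')] at h
        -- Both faces lie at the same nonzero height, so the height of a point of the cone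
        -- determines its scaling factor.
        obtain rfl := mul_right_cancel₀ hz h
        rcases eq_or_ne s 0 with rfl | hs0
        · obtain ⟨w, hw⟩ := hne
          exact ⟨0, le_rfl, zero_le_one, w, hw, by simp⟩
        · obtain rfl := smul_right_injective _ hs0 hzy
          exact ⟨s, hs, hs1, z, ⟨hy, hz'⟩, rfl⟩
    have := MeasureTheory.measure_union_add_inter₀ (μ := MeasureTheory.volume)
      (convexHull ℝ (insert 0 (face P u)))
      ((convex_convexHull ℝ (insert 0 (face Q u))).nullMeasurableSet MeasureTheory.volume)
    rw [← hcU, ← hcI] at this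
    unfold coneVolume
    rw [← ENNReal.toNNReal_add (hP.volume_cone_ne_top u) (hQ.volume_cone_ne_top u),
      ← ENNReal.toNNReal_add (hU.volume_cone_ne_top u) (hI.volume_cone_ne_top u), this]

theorem isValuation_facetVector {n : ℕ} {ζ : ℝ≥0 → ℝ} (hζ : IsCauchySolution ζ) :
    IsValuation fun P : PolytopeO n => facetVector ζ P.1 := by
  intro P Q U I hU hI
  classical
  have hfin := fun X : PolytopeO n => X.2.1.finite_facetNormals
  let N : Finset (RSpace n) := (hfin P).toFinset ∪ (hfin Q).toFinset ∪ (hfin U).toFinset ∪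
    (hfin I).toFinset
  have hsum : ∀ X ∈ [P, Q, U, I], facetVector ζ X.1 = ∑ u ∈ N, facetTerm ζ X.1 u := by
    intro X hX
    refine facetVector_eq_sum hζ X.2.1 (fun u hu => ?_) fun u hu huN => ?_
    · simp only [N, Finset.mem_union, Set.Finite.mem_toFinset] at hu
      rcases hu with ((hu | hu) | hu) | hu <;> exact hu.1
    · refine facetTerm_eq_zero hζ X.2.1 hu fun h => huN ?_
      simp only [N, Finset.mem_union, Set.Finite.mem_toFinset]
      simp only [List.mem_cons, List.not_mem_nil, or_false] at hX
      rcases hX with rfl | rfl | rfl | rfl <;> simp [h.1]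
  simp only
  rw [hsum P (by simp), hsum Q (by simp), hsum U (by simp), hsum I (by simp),
    ← Finset.sum_add_distrib, ← Finset.sum_add_distrib]
  refine Finset.sum_congr rfl fun u _ => ?_
  have hUp := U.2.1
  have hIp := I.2.1
  rw [hU] at hUp ⊢
  rw [hI] at hIp ⊢
  exact facetTerm_add_facetTerm hζ P.2.1 Q.2.1 hUp hIp ⟨P.2.2, Q.2.2⟩ u

end FacetVectorValuation

/-! ### Simplices at the origin, their volumes and facet vectors. -/

section Simplices

/-- The polytope spanned by the origin and a finite set of points. -/
noncomputable def hullO {n : ℕ} (V : Set (RSpace n)) (hV : V.Finite) : PolytopeO n :=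
  ⟨convexHull ℝ (insert 0 V), by
    classical
    exact ⟨insert 0 hV.toFinset, Finset.insert_nonempty _ _, by simp⟩,
    subset_convexHull ℝ _ (Set.mem_insert _ _)⟩

/-- The simplex spanned by the origin and the basis vectors with index in `S`. -/
noncomputable def simplexO {n : ℕ} (b : Module.Basis (Fin n) ℝ (RSpace n)) (S : Set (Fin n)) :
    PolytopeO n :=
  hullO (b '' S) (Set.toFinite _)

theorem mem_simplexO {n : ℕ} (b : Module.Basis (Fin n) ℝ (RSpace n)) (S : Set (Fin n))
    (x : RSpace n) : x ∈ (simplexO b S).1 ↔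
      (∀ i, 0 ≤ b.repr x i) ∧ (∀ i ∉ S, b.repr x i = 0) ∧ ∑ i, b.repr x i ≤ 1 := by
  classical
  change x ∈ convexHull ℝ (insert 0 (b '' S)) ↔ _
  rw [Set.image_eq_range, mem_convexHull_insert_zero_range]
  have hsum : ∀ {M : Type} [AddCommMonoid M] (f : S → M) (g : Fin n → M), (∀ i ∉ S, g i = 0) →
      (∀ i, f i = g i) → ∑ i : S, f i = ∑ i, g i := fun f g hg hfg =>
    Fintype.sum_of_injective Subtype.val Subtype.val_injective f g
      (fun i hi => hg i (by simpa using hi)) hfg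
  constructor
  · rintro ⟨t, ht, ht1, rfl⟩
    let s : Fin n → ℝ := fun i => if h : i ∈ S then t ⟨i, h⟩ else 0
    have hs : ∀ i ∉ S, s i = 0 := fun i hi => dif_neg hi
    have hst : ∀ i : S, t i = s i := fun i => by simp [s]
    rw [hsum (fun i => t i • b i) (fun i => s i • b i) (fun i hi => by simp only [hs i hi, zero_smul])
      (fun i => by simp only [hst]), b.repr_sum_self]
    refine ⟨fun i => ?_, hs, ?_⟩
    · by_cases h : i ∈ S
      · exact (hst ⟨i, h⟩) ▸ ht _
      · exact (hs i h).ge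
    · rwa [← hsum t s hs hst]
  · rintro ⟨h0, hS, h1⟩
    refine ⟨fun i => b.repr x i, fun i => h0 _, ?_, ?_⟩
    · rwa [hsum _ (fun i => b.repr x i) hS fun _ => rfl]
    · rw [hsum _ (fun i => b.repr x i • b i) (fun i hi => by simp only [hS i hi, zero_smul])
        fun _ => rfl, b.sum_repr]

theorem simplexO_image {n : ℕ} {b b' : Module.Basis (Fin n) ℝ (RSpace n)} {S S' : Set (Fin n)}
    (φ : RSpace n →ₗ[ℝ] RSpace n) (h : φ '' (b '' S) = b' '' S') :
    (simplexO b' S').1 = φ '' (simplexO b S).1 := by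
  change convexHull ℝ _ = φ '' convexHull ℝ _
  rw [LinearMap.image_convexHull, Set.image_insert_eq, h, map_zero]

theorem eq_of_inner_basis {n : ℕ} (b : Module.Basis (Fin n) ℝ (RSpace n)) {x y : RSpace n}
    (h : ∀ i, ⟪x, b i⟫ = ⟪y, b i⟫) : x = y := by
  refine ext_inner_right ℝ fun v => ?_
  rw [← b.sum_repr v, inner_sum, inner_sum]
  simp_rw [real_inner_smul_right, h]

/-- Every linearly independent set spans, with the origin, a face of a simplex. -/
theorem exists_basis_image_eq {n : ℕ} {V : Set (RSpace n)} (hV : LinearIndepOn ℝ id V) :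
    ∃ (b : Module.Basis (Fin n) ℝ (RSpace n)) (S : Set (Fin n)), b '' S = V := by
  let c := Module.Basis.extend hV
  have : Fintype (hV.extend (Set.subset_univ V)) := FiniteDimensional.fintypeBasisIndex c
  have hcard : Fintype.card (hV.extend (Set.subset_univ V)) = n := by
    rw [← Module.finrank_eq_card_basis c, finrank_euclideanSpace_fin]
  let e := Fintype.equivFinOfCardEq hcard
  refine ⟨c.reindex e, c.reindex e ⁻¹' V, Set.image_preimage_eq_of_subset ?_⟩
  rw [Module.Basis.range_reindex, Module.Basis.range_extend]
  exact Module.Basis.subset_extend hV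

/-- The volume of the simplex spanned by the origin and a basis. -/
noncomputable def simplexVolume {n : ℕ} (b : Module.Basis (Fin n) ℝ (RSpace n)) : ℝ≥0 :=
  (MeasureTheory.volume (simplexO b Set.univ).1).toNNReal

theorem volume_simplexO_ne_top {n : ℕ} (b : Module.Basis (Fin n) ℝ (RSpace n)) :
    MeasureTheory.volume (simplexO b Set.univ).1 ≠ ⊤ := by
  obtain ⟨s, -, hs⟩ := (simplexO b Set.univ).2.1
  rw [hs]
  exact (s.finite_toSet.isCompact_convexHull ℝ).measure_lt_top.ne

theorem simplexVolume_ne_zero {n : ℕ} (b : Module.Basis (Fin n) ℝ (RSpace n)) :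
    simplexVolume b ≠ 0 := by
  have hint : (interior (simplexO b Set.univ).1).Nonempty := by
    change (interior (convexHull ℝ _)).Nonempty
    rw [interior_convexHull_nonempty_iff_affineSpan_eq_top]
    apply SetLike.coe_injective
    rw [affineSpan_insert_zero, Set.image_univ, b.span_eq]
    rfl
  rw [simplexVolume, Ne, ENNReal.toNNReal_eq_zero_iff, not_or]
  exact ⟨((isOpen_interior.measure_pos _ hint).trans_le
    (MeasureTheory.measure_mono interior_subset)).ne', volume_simplexO_ne_top b⟩

theorem simplexVolume_of_map {n : ℕ} {b b' : Module.Basis (Fin n) ℝ (RSpace n)}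
    {φ : RSpace n →ₗ[ℝ] RSpace n} (h : ∀ i, φ (b i) = b' i) :
    simplexVolume b' = Real.nnabs (LinearMap.det φ) * simplexVolume b := by
  have hset := simplexO_image (b := b) (b' := b') (S := Set.univ) (S' := Set.univ) φ
    (by rw [Set.image_image]; simp_rw [h])
  rw [simplexVolume, hset, MeasureTheory.Measure.addHaar_image_linearMap, ENNReal.toNNReal_mul,
    simplexVolume, ← Real.toNNReal_abs]
  rfl

/-- The image of a basis under a linear map with nonzero determinant. -/
noncomputable def mapBasis {n : ℕ} (b : Module.Basis (Fin n) ℝ (RSpace n))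
    (φ : RSpace n →ₗ[ℝ] RSpace n) (hφ : LinearMap.det φ ≠ 0) :
    Module.Basis (Fin n) ℝ (RSpace n) :=
  b.map (φ.equivOfDetNeZero hφ)

theorem mapBasis_apply {n : ℕ} (b : Module.Basis (Fin n) ℝ (RSpace n))
    (φ : RSpace n →ₗ[ℝ] RSpace n) (hφ : LinearMap.det φ ≠ 0) (i : Fin n) :
    mapBasis b φ hφ i = φ (b i) := rfl

theorem exists_simplexVolume_eq {n : ℕ} (hn : 0 < n) {t : ℝ≥0} (ht : t ≠ 0) :
    ∃ b : Module.Basis (Fin n) ℝ (RSpace n), simplexVolume b = t := by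
  let b := (EuclideanSpace.basisFun (Fin n) ℝ).toBasis
  let i : Fin n := ⟨0, hn⟩
  let r : ℝ≥0 := t / simplexVolume b
  have hr : r ≠ 0 := div_ne_zero ht (simplexVolume_ne_zero b)
  -- This map stretches `b i` by the factor `r` and fixes the other basis vectors.
  have hdet : LinearMap.det (LinearMap.transvection (b.coord i) (((r : ℝ) - 1) • b i)) = r := by
    rw [LinearMap.transvection.det]
    simp
  have hne : LinearMap.det (LinearMap.transvection (b.coord i) (((r : ℝ) - 1) • b i)) ≠ 0 := by
    rw [hdet]; exact_mod_cast hr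
  refine ⟨mapBasis b _ hne, ?_⟩
  rw [simplexVolume_of_map (b := b) fun i => (mapBasis_apply b _ hne i).symm, hdet,
    Real.nnabs_coe, div_mul_cancel₀ _ (simplexVolume_ne_zero b)]

theorem facetVector_simplexO_of_ne_univ {n : ℕ} {ζ : ℝ≥0 → ℝ} (hζ : IsCauchySolution ζ)
    (b : Module.Basis (Fin n) ℝ (RSpace n)) {S : Set (Fin n)} (hS : S ≠ Set.univ) :
    facetVector ζ (simplexO b S).1 = 0 := by
  obtain ⟨m, hm⟩ := (Set.ne_univ_iff_exists_notMem S).1 hS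
  rw [facetVector_eq_sum hζ (simplexO b S).2.1 (N := ∅) (by simp), Finset.sum_empty]
  intro u _ _
  have hvol : MeasureTheory.volume (convexHull ℝ (insert 0 (face (simplexO b S).1 u))) = 0 := by
    refine volume_eq_zero_of_subset_submodule (p := LinearMap.ker (b.coord m)) ?_ ?_
    · refine convexHull_min ?_ (Submodule.convex _)
      rintro x (rfl | hx)
      · exact Submodule.zero_mem _
      · exact ((mem_simplexO b S x).1 hx.1).2.1 m hm
    · intro h
      have : b m ∈ LinearMap.ker (b.coord m) := h ▸ Submodule.mem_top
      simp at this
  rw [facetTerm, coneVolume, hvol, ENNReal.toNNReal_zero, hζ.map_zero, zero_div, zero_smul]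

/-- Only the facet opposite the origin contributes. If `w` pairs to `1` with every basis vector,
that facet has normal `‖w‖⁻¹ • w` and support value `‖w‖⁻¹`, and its cone is the whole simplex. The
facet vector is therefore `ζ (simplexVolume b) • w`. -/
theorem inner_facetVector_simplexO {n : ℕ} {ζ : ℝ≥0 → ℝ} (hζ : IsCauchySolution ζ)
    (b : Module.Basis (Fin n) ℝ (RSpace n)) (i : Fin n) :
    ⟪facetVector ζ (simplexO b Set.univ).1, b i⟫ = ζ (simplexVolume b) := by
  set T := (simplexO b Set.univ).1 with hT
  have hTp : IsPolytope T := (simplexO b Set.univ).2.1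
  have hT0 : (0 : RSpace n) ∈ T := (simplexO b Set.univ).2.2
  have hbT : ∀ j, b j ∈ T := fun j =>
    subset_convexHull ℝ _ (Set.mem_insert_of_mem _ ⟨j, Set.mem_univ _, rfl⟩)
  obtain ⟨w, hw⟩ : ∃ w : RSpace n, ∀ j, ⟪b j, w⟫ = 1 := by
    refine ⟨(InnerProductSpace.toDual ℝ (RSpace n)).symm
      (LinearMap.toContinuousLinearMap (b.constr ℝ fun _ => (1 : ℝ))), fun j => ?_⟩
    rw [real_inner_comm, InnerProductSpace.toDual_symm_apply]
    simp
  have hw0 : w ≠ 0 := by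
    rintro rfl
    have := hw i
    rw [inner_zero_right] at this
    exact zero_ne_one this
  have hwpos : 0 < ‖w‖ := norm_pos_iff.2 hw0
  have hinner : ∀ x u : RSpace n, ⟪x, u⟫ = ∑ j, b.repr x j * ⟪b j, u⟫ := by
    intro x u
    conv_lhs => rw [← b.sum_repr x, sum_inner]
    simp_rw [real_inner_smul_left]
  have hother : ∀ u : RSpace n, ‖u‖ = 1 → u ∉ ({‖w‖⁻¹ • w} : Finset (RSpace n)) →
      facetTerm ζ T u = 0 := by
    intro u hu huw
    rw [Finset.mem_singleton] at huw
    unfold facetTerm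
    have hnn := hTp.supportFn_nonneg hT0 u
    rcases hnn.eq_or_lt with h0 | hpos
    · simp [← h0]
    -- If all `b j` had maximal height, `u` would be a positive multiple of `w`. A vertex `b m`
    -- below that height forces the coordinate `m` to vanish on the face, so its cone is flat.
    have hex : ∃ m, ⟪b m, u⟫ < supportFn T u := by
      by_contra! hall
      have heq : ∀ j, ⟪b j, u⟫ = supportFn T u := fun j =>
        le_antisymm (hTp.inner_le_supportFn (hbT j) u) (hall j)
      have huw' : u = supportFn T u • w := eq_of_inner_basis b fun j => by
        rw [real_inner_comm, heq, real_inner_smul_left, real_inner_comm, hw, mul_one]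
      have hn := congrArg norm huw'
      rw [hu, norm_smul, Real.norm_of_nonneg hnn] at hn
      refine huw ?_
      rw [huw', inv_eq_of_mul_eq_one_left hn.symm]
    obtain ⟨m, hm⟩ := hex
    have hvol : MeasureTheory.volume (convexHull ℝ (insert 0 (face T u))) = 0 := by
      refine volume_eq_zero_of_subset_submodule (p := LinearMap.ker (b.coord m)) ?_ ?_
      · refine convexHull_min ?_ (Submodule.convex _)
        rintro x (rfl | hx)
        · exact Submodule.zero_mem _
        · have hxT := (mem_simplexO b Set.univ x).1 hx.1
          rw [hTp.face_eq] at hx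
          rw [SetLike.mem_coe, LinearMap.mem_ker, Module.Basis.coord_apply]
          refine le_antisymm (not_lt.1 fun hlt => ?_) (hxT.1 m)
          have hlt' : ⟪x, u⟫ < ∑ j, b.repr x j * supportFn T u := by
            rw [hinner]
            exact Finset.sum_lt_sum (fun j _ => mul_le_mul_of_nonneg_left
              (hTp.inner_le_supportFn (hbT j) u) (hxT.1 j))
              ⟨m, Finset.mem_univ _, mul_lt_mul_of_pos_left hm hlt⟩
          rw [hx.2, ← Finset.sum_mul] at hlt'
          nlinarith [hxT.2.2]
      · intro h
        have : b m ∈ LinearMap.ker (b.coord m) := h ▸ Submodule.mem_top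
        simp at this
    rw [coneVolume, hvol, ENNReal.toNNReal_zero, hζ.map_zero, zero_div, zero_smul]
  have hunit : ‖‖w‖⁻¹ • w‖ = 1 := by
    rw [norm_smul, norm_inv, norm_norm, inv_mul_cancel₀ hwpos.ne']
  rw [facetVector_eq_sum hζ hTp (N := {‖w‖⁻¹ • w}) (by simpa using hunit) hother,
    Finset.sum_singleton]
  have hbw : ∀ j, ⟪b j, ‖w‖⁻¹ • w⟫ = ‖w‖⁻¹ := fun j => by
    rw [real_inner_smul_right, hw, mul_one]
  have hle : ∀ x ∈ T, ⟪x, ‖w‖⁻¹ • w⟫ ≤ ‖w‖⁻¹ := by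
    intro x hx
    rw [hinner]
    simp_rw [hbw]
    rw [← Finset.sum_mul]
    exact mul_le_of_le_one_left (by positivity) ((mem_simplexO b _ x).1 hx).2.2
  have hsupp : supportFn T (‖w‖⁻¹ • w) = ‖w‖⁻¹ := by
    rw [hTp.supportFn_eq (hbT i) fun y hy => by rw [hbw]; exact hle y hy, hbw]
  have hcone : convexHull ℝ (insert 0 (face T (‖w‖⁻¹ • w))) = T := by
    apply Set.Subset.antisymm
    · refine convexHull_min ?_ hTp.convex
      rintro x (rfl | hx)
      exacts [hT0, hx.1]
    · refine convexHull_mono (Set.insert_subset_insert ?_)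
      rintro _ ⟨j, -, rfl⟩
      exact ⟨hbT j, fun y hy => by rw [hbw]; exact hle y hy⟩
  rw [facetTerm, coneVolume, hcone, hsupp, abs_of_pos (inv_pos.2 hwpos), smul_smul,
    real_inner_smul_left, real_inner_comm, hw, mul_one, div_mul_cancel₀ _ (inv_pos.2 hwpos).ne']
  rfl

end Simplices

/-! ### Contravariant valuations on simplices, and the Cauchy function. -/

section ContravariantValuations

theorem toEuclideanLin_transpose_inner {n : ℕ} (M : Matrix (Fin n) (Fin n) ℝ) (x y : RSpace n) :
    ⟪Matrix.toEuclideanLin M.transpose x, y⟫ = ⟪x, Matrix.toEuclideanLin M y⟫ := by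
  rw [← Matrix.conjTranspose_eq_transpose_of_trivial,
    Matrix.toEuclideanLin_conjTranspose_eq_adjoint, LinearMap.adjoint_inner_left]

theorem det_toEuclideanLin {n : ℕ} (M : Matrix (Fin n) (Fin n) ℝ) :
    LinearMap.det (Matrix.toEuclideanLin M) = M.det := by
  have h : Matrix.toEuclideanLin M =
      Matrix.toLin (PiLp.basisFun 2 ℝ (Fin n)) (PiLp.basisFun 2 ℝ (Fin n)) M := by
    rw [← Matrix.toLpLin_eq_toLin 2 2]
  rw [h, LinearMap.det_toLin]

theorem toEuclideanLin_inv_apply {n : ℕ} (φ : Matrix.SpecialLinearGroup (Fin n) ℝ)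
    (x : RSpace n) : Matrix.toEuclideanLin (φ⁻¹).1 (Matrix.toEuclideanLin φ.1 x) = x := by
  have h : (φ⁻¹).1 * φ.1 = 1 := by
    rw [← Matrix.SpecialLinearGroup.coe_mul, inv_mul_cancel, Matrix.SpecialLinearGroup.coe_one]
  ext i
  rw [Matrix.ofLp_toLpLin, Matrix.ofLp_toLpLin, Matrix.toLin'_apply, Matrix.toLin'_apply,
    Matrix.mulVec_mulVec, h, Matrix.one_mulVec]

/-- Contravariance, expressed through linear maps of determinant one. -/
theorem IsSLContravariant.inner_eq {n : ℕ} {Z : PolytopeO n → RSpace n} (hZ : IsSLContravariant Z)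
    {φ : RSpace n →ₗ[ℝ] RSpace n} (hφ : LinearMap.det φ = 1) {P U : PolytopeO n}
    (hU : U.1 = φ '' P.1) (x : RSpace n) : ⟪Z U, φ x⟫ = ⟪Z P, x⟫ := by
  obtain ⟨M, rfl⟩ := Matrix.toEuclideanLin.surjective φ
  rw [det_toEuclideanLin] at hφ
  have h := hZ ⟨M, hφ⟩ P
  have hUP : U = P.image ⟨M, hφ⟩ := Subtype.ext hU
  rw [hUP, h, toEuclideanLin_transpose_inner]
  congr 1
  exact toEuclideanLin_inv_apply ⟨M, hφ⟩ x

/-- The linear map that exchanges two basis vectors. -/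
noncomputable def basisSwap {n : ℕ} (b : Module.Basis (Fin n) ℝ (RSpace n)) (i j : Fin n) :
    RSpace n →ₗ[ℝ] RSpace n :=
  LinearMap.transvection (b.coord j - b.coord i) (b i - b j)

theorem basisSwap_apply {n : ℕ} (b : Module.Basis (Fin n) ℝ (RSpace n)) (i j k : Fin n) :
    basisSwap b i j (b k) = b (Equiv.swap i j k) := by
  rw [basisSwap, LinearMap.transvection.apply, LinearMap.sub_apply, Module.Basis.coord_apply,
    Module.Basis.coord_apply, b.repr_self, Finsupp.single_apply, Finsupp.single_apply,
    Equiv.swap_apply_def]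
  split_ifs <;> simp_all

theorem det_basisSwap {n : ℕ} (b : Module.Basis (Fin n) ℝ (RSpace n)) {i j : Fin n} (h : i ≠ j) :
    LinearMap.det (basisSwap b i j) = -1 := by
  rw [basisSwap, LinearMap.transvection.det]
  simp [h, h.symm]

theorem exists_ne_ne {n : ℕ} (hn : 3 ≤ n) (i j : Fin n) : ∃ k, k ≠ i ∧ k ≠ j := by
  have : ((Finset.univ : Finset (Fin n)) \ {i, j}).Nonempty := by
    rw [← Finset.card_pos]
    have h1 := Finset.le_card_sdiff ({i, j} : Finset (Fin n)) Finset.univ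
    have h2 := Finset.card_le_two (a := i) (b := j)
    rw [Finset.card_univ, Fintype.card_fin] at h1
    omega
  obtain ⟨k, hk⟩ := this
  exact ⟨k, by simpa [not_or] using hk⟩

variable {n : ℕ} {Z : PolytopeO n → RSpace n}

/-- A contravariant function vanishes on lower-dimensional simplices. -/
theorem IsSLContravariant.simplexO_eq_zero (hn : 3 ≤ n) (hZ : IsSLContravariant Z)
    (b : Module.Basis (Fin n) ℝ (RSpace n)) {S : Set (Fin n)} (hS : S ≠ Set.univ) :
    Z (simplexO b S) = 0 := by
  obtain ⟨m, hm⟩ := (Set.ne_univ_iff_exists_notMem S).1 hS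
  -- The shear `b i ↦ b i + b j` fixes the simplex pointwise because `i ∉ S`; pairing with `b i`
  -- gives the claim.
  have hshear : ∀ i j, i ≠ j → i ∉ S → ⟪Z (simplexO b S), b j⟫ = 0 := by
    intro i j hij hi
    have hdet : LinearMap.det (LinearMap.transvection (b.coord i) (b j)) = 1 := by
      rw [LinearMap.transvection.det]
      simp [hij.symm]
    have himg : LinearMap.transvection (b.coord i) (b j) '' (b '' S) = b '' S := by
      rw [Set.image_image]
      refine Set.image_congr fun k hk => ?_
      have hki : k ≠ i := fun h => hi (h ▸ hk)
      rw [LinearMap.transvection.apply]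
      simp [hki]
    have h := hZ.inner_eq hdet (simplexO_image _ himg) (b i)
    rw [LinearMap.transvection.apply, inner_add_right] at h
    simpa using h
  refine eq_of_inner_basis b fun j => ?_
  rw [inner_zero_left]
  rcases eq_or_ne m j with rfl | hmj
  swap
  · exact hshear m j hmj hm
  by_cases hex : ∃ i, m ≠ i ∧ i ∉ S
  · obtain ⟨i, hi, hiS⟩ := hex
    exact hshear i m hi.symm hiS
  push Not at hex
  obtain ⟨i, him, -⟩ := exists_ne_ne hn m m
  obtain ⟨j, hjm, hji⟩ := exists_ne_ne hn m i
  -- Here only `m` is missing from `S`. The coefficient `-2` gives the reflection `b m ↦ -b m`, and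
  -- exchanging two other vertices restores determinant one. The map preserves the simplex and
  -- negates `⟪Z _, b m⟫`. Two further indices require `3 ≤ n`.
  have hdet : LinearMap.det (LinearMap.transvection (b.coord m) ((-2 : ℝ) • b m) ∘ₗ
      basisSwap b i j) = 1 := by
    rw [LinearMap.det_comp, LinearMap.transvection.det, det_basisSwap b hji.symm]
    simp
    norm_num
  have himg : (LinearMap.transvection (b.coord m) ((-2 : ℝ) • b m) ∘ₗ basisSwap b i j) ''
      (b '' S) = b '' S := by
    have hSm : ∀ k, k ∈ S ↔ k ≠ m := fun k =>
      ⟨fun hk h => hm (h ▸ hk), fun hk => hex k hk.symm⟩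
    have hswap : ∀ k, k ∈ S → Equiv.swap i j k ∈ S := by
      intro k hk
      rw [hSm] at hk ⊢
      rw [Equiv.swap_apply_def]
      split_ifs <;> assumption
    have himg' : ∀ k ∈ S, (LinearMap.transvection (b.coord m) ((-2 : ℝ) • b m) ∘ₗ
        basisSwap b i j) (b k) = b (Equiv.swap i j k) := by
      intro k hk
      have := (hSm _).1 (hswap k hk)
      rw [LinearMap.comp_apply, basisSwap_apply, LinearMap.transvection.apply]
      simp [this]
    rw [Set.image_image, Set.image_congr himg']
    apply Set.Subset.antisymm
    · rintro _ ⟨k, hk, rfl⟩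
      exact ⟨_, hswap k hk, rfl⟩
    · rintro _ ⟨k, hk, rfl⟩
      exact ⟨_, hswap k hk, by simp⟩
  have h := hZ.inner_eq hdet (simplexO_image _ himg) (b m)
  rw [LinearMap.comp_apply, basisSwap_apply, Equiv.swap_apply_of_ne_of_ne him.symm hjm.symm,
    LinearMap.transvection.apply, inner_add_right] at h
  simp [real_inner_smul_right] at h
  linarith

/-- A single transposition has determinant `-1`; a 3-cycle sending `i` to `j` has determinant one
and preserves the simplex. -/
theorem IsSLContravariant.inner_simplexO_eq (hn : 3 ≤ n) (hZ : IsSLContravariant Z)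
    (b : Module.Basis (Fin n) ℝ (RSpace n)) (i j : Fin n) :
    ⟪Z (simplexO b Set.univ), b i⟫ = ⟪Z (simplexO b Set.univ), b j⟫ := by
  rcases eq_or_ne i j with rfl | hij
  · rfl
  obtain ⟨l, hli, hlj⟩ := exists_ne_ne hn i j
  have hdet : LinearMap.det (basisSwap b i j ∘ₗ basisSwap b j l) = 1 := by
    rw [LinearMap.det_comp, det_basisSwap b hij, det_basisSwap b hlj.symm]
    norm_num
  have himg : (basisSwap b i j ∘ₗ basisSwap b j l) '' (b '' Set.univ) = b '' Set.univ := by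
    simp only [Set.image_univ]
    rw [← Set.range_comp]
    have : (basisSwap b i j ∘ₗ basisSwap b j l) ∘ b = b ∘ (Equiv.swap i j * Equiv.swap j l :
        Equiv.Perm (Fin n)) := by
      funext k
      simp [basisSwap_apply]
    rw [this, Set.range_comp, Equiv.range_eq_univ, Set.image_univ]
  have h := hZ.inner_eq hdet (simplexO_image _ himg) (b i)
  rw [LinearMap.comp_apply, basisSwap_apply, Equiv.swap_apply_of_ne_of_ne hij hli.symm,
    basisSwap_apply, Equiv.swap_apply_left] at h
  exact h.symm

/-- On full-dimensional simplices the value of a contravariant function depends only on the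
volume. -/
theorem IsSLContravariant.inner_simplexO_congr (hn : 3 ≤ n) (hZ : IsSLContravariant Z)
    {b b' : Module.Basis (Fin n) ℝ (RSpace n)} (h : simplexVolume b = simplexVolume b')
    (i j : Fin n) :
    ⟪Z (simplexO b Set.univ), b i⟫ = ⟪Z (simplexO b' Set.univ), b' j⟫ := by
  rw [hZ.inner_simplexO_eq hn b' j i]
  let φ : RSpace n →ₗ[ℝ] RSpace n := (b.equiv b' (Equiv.refl _)).toLinearMap
  have hφ : ∀ k, φ (b k) = b' k := fun k => by simp [φ]
  have himg : φ '' (b '' Set.univ) = b' '' Set.univ := by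
    rw [Set.image_image]; simp_rw [hφ]
  have hdet : |LinearMap.det φ| = 1 := by
    have := simplexVolume_of_map hφ
    rw [← h] at this
    have h1 := mul_right_cancel₀ (simplexVolume_ne_zero b) ((one_mul _).trans this)
    rw [← Real.coe_nnabs, ← h1, NNReal.coe_one]
  rcases (abs_eq zero_le_one).1 hdet with hd | hd
  · rw [← hφ, hZ.inner_eq hd (simplexO_image _ himg)]
  -- An exchange of two vertices of the target simplex corrects the orientation.
  · obtain ⟨j, hji, -⟩ := exists_ne_ne hn i i
    have hd' : LinearMap.det (basisSwap b' i j ∘ₗ φ) = 1 := by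
      rw [LinearMap.det_comp, det_basisSwap b' hji.symm, hd]; norm_num
    have himg' : (basisSwap b' i j ∘ₗ φ) '' (b '' Set.univ) = b' '' Set.univ := by
      rw [LinearMap.coe_comp, Set.image_comp, himg, Set.image_univ, ← Set.range_comp]
      have : basisSwap b' i j ∘ b' = b' ∘ Equiv.swap i j := by
        funext k; simp [basisSwap_apply]
      rw [this, Set.range_comp, Equiv.range_eq_univ, Set.image_univ]
    have := hZ.inner_eq hd' (simplexO_image _ himg') (b i)
    rw [LinearMap.comp_apply, hφ, basisSwap_apply, Equiv.swap_apply_left] at this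
    rw [← this, hZ.inner_simplexO_eq hn b' j i]

/-- The shear that moves the vertex `b i` of a simplex along the edge towards `b j`. -/
theorem mem_image_edge_shear (b : Module.Basis (Fin n) ℝ (RSpace n)) {i j : Fin n} (hij : i ≠ j)
    {l : ℝ} (hl0 : 0 < l) (hl1 : l < 1) (x : RSpace n) :
    x ∈ LinearMap.transvection (b.coord i) (l • (b j - b i)) '' (simplexO b Set.univ).1 ↔
      x ∈ (simplexO b Set.univ).1 ∧ l * b.repr x i ≤ (1 - l) * b.repr x j := by
  have hrepr : ∀ (c : ℝ) (y : RSpace n) (k : Fin n),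
      b.repr (LinearMap.transvection (b.coord i) (c • (b j - b i)) y) k =
      b.repr y k + b.repr y i * c * ((if k = j then 1 else 0) - if k = i then 1 else 0) := by
    intro c y k
    rw [LinearMap.transvection.apply]
    simp [Finsupp.single_apply, eq_comm, mul_assoc]
  have hsum : ∀ (c : ℝ) (y : RSpace n),
      ∑ k, b.repr (LinearMap.transvection (b.coord i) (c • (b j - b i)) y) k =
        ∑ k, b.repr y k := by
    intro c y
    simp_rw [hrepr, Finset.sum_add_distrib, ← Finset.mul_sum, Finset.sum_sub_distrib]
    simp
  have hi : ∀ (c : ℝ) (y : RSpace n),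
      b.repr (LinearMap.transvection (b.coord i) (c • (b j - b i)) y) i =
        (1 - c) * b.repr y i := by
    intro c y
    rw [hrepr, if_neg hij, if_pos rfl]; ring
  have hj : ∀ (c : ℝ) (y : RSpace n),
      b.repr (LinearMap.transvection (b.coord i) (c • (b j - b i)) y) j =
        b.repr y j + c * b.repr y i := by
    intro c y
    rw [hrepr, if_neg hij.symm, if_pos rfl]; ring
  have hk : ∀ (c : ℝ) (y : RSpace n) (k), k ≠ i → k ≠ j →
      b.repr (LinearMap.transvection (b.coord i) (c • (b j - b i)) y) k = b.repr y k := by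
    intro c y k h1 h2
    rw [hrepr, if_neg h1, if_neg h2]; ring
  have hl1' : 0 < 1 - l := sub_pos.2 hl1
  simp only [mem_simplexO, Set.mem_image, Set.mem_univ, not_true_eq_false, false_imp_iff,
    implies_true, true_and]
  constructor
  · rintro ⟨y, ⟨h0, h1⟩, rfl⟩
    refine ⟨⟨fun k => ?_, (hsum l y).trans_le h1⟩, ?_⟩
    · rcases eq_or_ne k i with rfl | hki
      · rw [hi]; exact mul_nonneg hl1'.le (h0 _)
      · rcases eq_or_ne k j with rfl | hkj
        · rw [hj]; exact add_nonneg (h0 _) (mul_nonneg hl0.le (h0 _))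
        · rw [hk l y k hki hkj]; exact h0 k
    · rw [hi, hj]
      nlinarith [mul_nonneg hl1'.le (h0 j)]
  · rintro ⟨⟨h0, h1⟩, hle⟩
    -- The shear scales the coordinate `i` by `1 - l`; the parameter `-(l / (1 - l))` scales it by
    -- `1 / (1 - l)`, giving the inverse.
    have hinv : LinearMap.transvection (b.coord i) (l • (b j - b i))
        (LinearMap.transvection (b.coord i) ((-(l / (1 - l))) • (b j - b i)) x) = x := by
      refine b.ext_elem fun k => ?_
      rcases eq_or_ne k i with rfl | hki
      · rw [hi, hi]; field_simp; ring
      · rcases eq_or_ne k j with rfl | hkj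
        · rw [hj, hj, hi]; field_simp; ring
        · rw [hk _ _ k hki hkj, hk _ _ k hki hkj]
    refine ⟨_, ⟨fun k => ?_, (hsum _ x).trans_le h1⟩, hinv⟩
    rcases eq_or_ne k i with rfl | hki
    · rw [hi]
      refine mul_nonneg ?_ (h0 _)
      have := div_nonneg hl0.le hl1'.le
      linarith
    · rcases eq_or_ne k j with rfl | hkj
      · rw [hj]
        have : b.repr x k + -(l / (1 - l)) * b.repr x i =
            ((1 - l) * b.repr x k - l * b.repr x i) / (1 - l) := by
          field_simp
          ring
        rw [this]
        exact div_nonneg (sub_nonneg.2 hle) hl1'.le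
      · rw [hk _ x k hki hkj]; exact h0 k

/-- Cutting a simplex through the point that divides one of its edges in the ratio `l : 1 - l`. -/
theorem exists_simplexO_bisection (hn : 3 ≤ n) (hV : IsValuation Z) (hZ : IsSLContravariant Z)
    (b : Module.Basis (Fin n) ℝ (RSpace n)) {l : ℝ≥0} (hl0 : 0 < l) (hl1 : l < 1) (i : Fin n) :
    ∃ b₁ b₂ : Module.Basis (Fin n) ℝ (RSpace n),
      simplexVolume b₁ = (1 - l) * simplexVolume b ∧ simplexVolume b₂ = l * simplexVolume b ∧
      ⟪Z (simplexO b₁ Set.univ), b₁ i⟫ + ⟪Z (simplexO b₂ Set.univ), b₂ i⟫ =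
        ⟪Z (simplexO b Set.univ), b i⟫ := by
  obtain ⟨j, hji, -⟩ := exists_ne_ne hn i i
  have h0 : (0 : ℝ) < l := by exact_mod_cast hl0
  have h1 : (l : ℝ) < 1 := by exact_mod_cast hl1
  have hd₁ : LinearMap.det (LinearMap.transvection (b.coord i) ((l : ℝ) • (b j - b i))) =
      1 - l := by
    rw [LinearMap.transvection.det]; simp [hji]; ring
  have hd₂ : LinearMap.det (LinearMap.transvection (b.coord j) ((1 - l : ℝ) • (b i - b j))) =
      l := by
    rw [LinearMap.transvection.det]; simp [hji.symm]
  set φ₁ := LinearMap.transvection (b.coord i) ((l : ℝ) • (b j - b i)) with hφ₁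
  set φ₂ := LinearMap.transvection (b.coord j) ((1 - l : ℝ) • (b i - b j)) with hφ₂
  have hne₁ : LinearMap.det φ₁ ≠ 0 := by rw [hd₁]; linarith
  have hne₂ : LinearMap.det φ₂ ≠ 0 := by rw [hd₂]; linarith
  let b₁ := mapBasis b φ₁ hne₁
  let b₂ := mapBasis b φ₂ hne₂
  have hb₁ : ∀ k, φ₁ (b k) = b₁ k := fun k => rfl
  have hb₂ : ∀ k, φ₂ (b k) = b₂ k := fun k => rfl
  have hT₁ : (simplexO b₁ Set.univ).1 = φ₁ '' (simplexO b Set.univ).1 :=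
    simplexO_image _ (by rw [Set.image_image]; rfl)
  have hT₂ : (simplexO b₂ Set.univ).1 = φ₂ '' (simplexO b Set.univ).1 :=
    simplexO_image _ (by rw [Set.image_image]; rfl)
  have hm₁ := fun x => mem_image_edge_shear b hji.symm h0 h1 x
  have hm₂ : ∀ x, x ∈ φ₂ '' (simplexO b Set.univ).1 ↔ x ∈ (simplexO b Set.univ).1 ∧
      (1 - l : ℝ) * b.repr x j ≤ l * b.repr x i := fun x => by
    have := mem_image_edge_shear b hji (l := 1 - l) (by linarith) (by linarith) x
    rwa [sub_sub_cancel] at this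
  -- Both pieces share the dividing point as a vertex: it replaces `b i` in `b₁` and `b j` in `b₂`.
  have hp₁ : b₁ i = (1 - l : ℝ) • b i + (l : ℝ) • b j := by
    rw [← hb₁, hφ₁, LinearMap.transvection.apply]
    simp only [Module.Basis.coord_apply, Module.Basis.repr_self, Finsupp.single_eq_same]
    module
  have hp₂ : b₂ j = (1 - l : ℝ) • b i + (l : ℝ) • b j := by
    rw [← hb₂, hφ₂, LinearMap.transvection.apply]
    simp only [Module.Basis.coord_apply, Module.Basis.repr_self, Finsupp.single_eq_same]
    module
  have hSj : ({j}ᶜ : Set (Fin n)) ≠ Set.univ := by simp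
  have hval := hV (simplexO b₁ Set.univ) (simplexO b₂ Set.univ) (simplexO b Set.univ)
    (simplexO b₁ {j}ᶜ) (by
      ext x
      rw [hT₁, hT₂, Set.mem_union, hm₁, hm₂, ← and_or_left]
      exact (and_iff_left (le_total _ _)).symm) (by
      have : (simplexO b₁ {j}ᶜ).1 = φ₁ '' (simplexO b {j}ᶜ).1 :=
        simplexO_image _ (by rw [Set.image_image]; rfl)
      ext x
      have hri : ∀ y, b.repr (φ₁ y) i = (1 - l) * b.repr y i := fun y => by
        rw [hφ₁, LinearMap.transvection.apply]
        simp [hji]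
        ring
      have hrj : ∀ y, b.repr (φ₁ y) j = b.repr y j + l * b.repr y i := fun y => by
        rw [hφ₁, LinearMap.transvection.apply]
        simp [hji.symm, mul_comm]
      rw [Set.mem_inter_iff, this, hT₁, hT₂, hm₂]
      constructor
      · rintro ⟨y, hy, rfl⟩
        rw [mem_simplexO] at hy
        have hyj : b.repr y j = 0 := hy.2.1 j (by simp)
        have hmem : φ₁ y ∈ φ₁ '' (simplexO b Set.univ).1 :=
          ⟨y, (mem_simplexO _ _ _).2 ⟨hy.1, by simp, hy.2.2⟩, rfl⟩
        refine ⟨hmem, ((hm₁ _).1 hmem).1, ?_⟩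
        rw [hri, hrj, hyj]
        exact le_of_eq (by ring)
      · rintro ⟨⟨y, hy, rfl⟩, -, hle⟩
        rw [mem_simplexO] at hy
        refine ⟨y, (mem_simplexO _ _ _).2 ⟨hy.1, fun k hk => ?_, hy.2.2⟩, rfl⟩
        have hkj : k = j := by simpa using hk
        rw [hri, hrj] at hle
        rw [hkj]
        exact le_antisymm (by nlinarith) (hy.1 j))
  rw [hZ.simplexO_eq_zero hn b₁ hSj, add_zero] at hval
  refine ⟨b₁, b₂, ?_, ?_, ?_⟩
  · rw [simplexVolume_of_map hb₁, hd₁]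
    congr 1
    rw [Real.nnabs_of_nonneg (by linarith), ← NNReal.coe_one, ← NNReal.coe_sub hl1.le,
      Real.toNNReal_coe]
  · rw [simplexVolume_of_map hb₂, hd₂, Real.nnabs_coe]
  -- The common face contributes nothing, so the values of `Z` on the pieces add up. Pairing with
  -- the shared vertex gives a convex combination of the equal numbers `⟪Z T, b i⟫` and `⟪Z T, b
  -- j⟫`, where `T` is the original simplex.
  · rw [hZ.inner_simplexO_eq hn b₂ i j, hp₁, hp₂, ← inner_add_left, hval, inner_add_right,
      real_inner_smul_right, real_inner_smul_right, hZ.inner_simplexO_eq hn b j i]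
    ring

/-- The Cauchy function of a contravariant valuation, as a function of the simplex volume. -/
theorem exists_isCauchySolution (hn : 3 ≤ n) (hV : IsValuation Z) (hZ : IsSLContravariant Z) :
    ∃ ζ : ℝ≥0 → ℝ, IsCauchySolution ζ ∧ ∀ (b : Module.Basis (Fin n) ℝ (RSpace n)) (i : Fin n),
      ⟪Z (simplexO b Set.univ), b i⟫ = ζ (simplexVolume b) := by
  classical
  let i₀ : Fin n := ⟨0, by omega⟩
  -- Every positive `t` is the volume of some simplex, so the default value is used only at `0`,
  -- where additivity requires it.
  let ζ : ℝ≥0 → ℝ := fun t =>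
    if h : ∃ b : Module.Basis (Fin n) ℝ (RSpace n), simplexVolume b = t then
      ⟪Z (simplexO h.choose Set.univ), h.choose i₀⟫ else 0
  have hζ : ∀ (b : Module.Basis (Fin n) ℝ (RSpace n)) (i : Fin n),
      ⟪Z (simplexO b Set.univ), b i⟫ = ζ (simplexVolume b) := by
    intro b i
    have hex : ∃ b' : Module.Basis (Fin n) ℝ (RSpace n), simplexVolume b' = simplexVolume b :=
      ⟨b, rfl⟩
    simp only [ζ]
    rw [dif_pos hex]
    exact hZ.inner_simplexO_congr hn hex.choose_spec.symm _ _
  have hζ0 : ζ 0 = 0 := dif_neg fun ⟨b, hb⟩ => simplexVolume_ne_zero b hb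
  refine ⟨ζ, fun s t => ?_, hζ⟩
  rcases eq_or_ne s 0 with rfl | hs
  · rw [zero_add, hζ0, zero_add]
  rcases eq_or_ne t 0 with rfl | ht
  · rw [add_zero, hζ0, add_zero]
  have hst : s + t ≠ 0 := by simp [hs]
  obtain ⟨b, hb⟩ := exists_simplexVolume_eq (n := n) (by omega) hst
  have hl1 : t / (s + t) < 1 := by
    rw [div_lt_one (pos_iff_ne_zero.2 hst)]
    exact lt_add_of_pos_left _ (pos_iff_ne_zero.2 hs)
  -- The ratio `t / (s + t)` divides a simplex of volume `s + t` into pieces of volumes `s` and `t`.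
  obtain ⟨b₁, b₂, h₁, h₂, h⟩ := exists_simplexO_bisection hn hV hZ b (l := t / (s + t))
    (div_pos (pos_iff_ne_zero.2 ht) (pos_iff_ne_zero.2 hst)) hl1 i₀
  rw [hζ, hζ, hζ, h₁, h₂, hb, div_mul_cancel₀ _ hst, tsub_mul, one_mul, div_mul_cancel₀ _ hst,
    add_tsub_cancel_right] at h
  exact h.symm

/-- Pulling the facet vector of `φ P` back by the transpose of `φ` gives another valuation in `P`.
It agrees with the facet vector on simplices, since `φ` preserves their volume, hence everywhere by
uniqueness. -/
theorem isSLContravariant_facetVector {ζ : ℝ≥0 → ℝ} (hζ : IsCauchySolution ζ) :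
    IsSLContravariant fun P : PolytopeO n => facetVector ζ P.1 := by
  intro φ P
  have hdet : LinearMap.det (Matrix.toEuclideanLin φ.1) = 1 := by
    rw [det_toEuclideanLin]; exact φ.2
  have hinj : Function.Injective (Matrix.toEuclideanLin φ.1) :=
    Function.LeftInverse.injective (toEuclideanLin_inv_apply φ)
  have hval : IsValuation fun P : PolytopeO n =>
      Matrix.toEuclideanLin φ.1.transpose (facetVector ζ (P.image φ).1) := by
    intro P Q U I hU hI
    have := isValuation_facetVector hζ (P.image φ) (Q.image φ) (U.image φ) (I.image φ)
      (by simp only [PolytopeO.image]; rw [hU, Set.image_union])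
      (by simp only [PolytopeO.image]; rw [hI, Set.image_inter hinj])
    simp only at this ⊢
    rw [← map_add, this, map_add]
  have heq := hval.eq_of_eq_on_simplices (isValuation_facetVector hζ) (by
    intro V hV U hU
    obtain ⟨b, S, rfl⟩ := exists_basis_image_eq hV
    obtain rfl : U = simplexO b S := Subtype.ext hU
    let b' := mapBasis b (Matrix.toEuclideanLin φ.1) (by rw [hdet]; exact one_ne_zero)
    have hb' : ∀ i, Matrix.toEuclideanLin φ.1 (b i) = b' i := fun i => rfl
    have himg : (simplexO b S).image φ = simplexO b' S := Subtype.ext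
      (simplexO_image (b' := b') (S' := S) (Matrix.toEuclideanLin φ.1)
        (by rw [Set.image_image]; rfl)).symm
    rw [himg]
    by_cases hS : S = Set.univ
    · subst hS
      refine eq_of_inner_basis b fun i => ?_
      rw [toEuclideanLin_transpose_inner, hb', inner_facetVector_simplexO hζ,
        inner_facetVector_simplexO hζ, simplexVolume_of_map hb', hdet, map_one, one_mul]
    · rw [facetVector_simplexO_of_ne_univ hζ b hS, facetVector_simplexO_of_ne_univ hζ b' hS,
        map_zero])
  have h := congrFun heq P
  simp only at h ⊢
  refine ext_inner_right ℝ fun y => ?_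
  rw [toEuclideanLin_transpose_inner, ← h, toEuclideanLin_transpose_inner]
  congr 1
  have := toEuclideanLin_inv_apply φ⁻¹ y
  rw [inv_inv] at this
  exact this.symm

end ContravariantValuations

theorem theorem1p1 (n : ℕ) (hn : 3 ≤ n) (Z : PolytopeO n → RSpace n) :
    (IsValuation Z ∧ IsSLContravariant Z) ↔
      ∃ ζ : ℝ≥0 → ℝ, IsCauchySolution ζ ∧ ∀ P : PolytopeO n, Z P = facetVector ζ P.1 := by
  constructor
  · rintro ⟨hV, hZ⟩
    obtain ⟨ζ, hζ, hvol⟩ := exists_isCauchySolution hn hV hZ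
    refine ⟨ζ, hζ, congrFun (hV.eq_of_eq_on_simplices (isValuation_facetVector hζ) ?_)⟩
    intro V hVi U hU
    obtain ⟨b, S, rfl⟩ := exists_basis_image_eq hVi
    obtain rfl : U = simplexO b S := Subtype.ext hU
    by_cases hS : S = Set.univ
    · subst hS
      exact eq_of_inner_basis b fun i => (hvol b i).trans (inner_facetVector_simplexO hζ b i).symm
    · rw [hZ.simplexO_eq_zero hn b hS, facetVector_simplexO_of_ne_univ hζ b hS]
  · rintro ⟨ζ, hζ, h⟩
    obtain rfl : Z = fun P => facetVector ζ P.1 := funext h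
    exact ⟨isValuation_facetVector hζ, isSLContravariant_facetVector hζ⟩
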